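/- There is an absolute constant $K$ such that the following holds for every $n \ge 2$ and every polytope $P \subset \mathbb{R}^n$ (the convex hull of a finite set) that has more than one point. Let $(U,V)$ be a uniformly random pair of orthonormal vectors in $\mathbb{R}^n$, i.e. distributed according to the unique $O(n)$-invariant probability measure on the set of orthonormal pairs, and let $\pi : \mathbb{R}^n \to \mathbb{R}^2$, $\pi(x) = (U^{\intercal} x, V^{\intercal} x)$. Let $s$ be the expected number of vertices of the random shadow $\pi(P)$ (the number of vertices is an integrable random variable). Then \[ \frac{2}{M}\,\mathrm{gdiam}(P) \;\le\; s \;\le\; \frac{K\sqrt{n}\,\pi}{2m}\,\mathrm{gdiam}(P), \] where $\mathrm{gdiam}(P) = \max_{x,y \in P} \|x-y\|_2$ is the geometric diameter of $P$, $m$ and $M$ are the minimal and maximal Euclidean lengths of the edges (one-dimensional faces) of $P$, and in the bounds $\pi$ denotes the number $3.14159\ldots$ -/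

import Mathlib

open MeasureTheory

noncomputable section

namespace RandomShadow

/-- `P` is a (convex) polytope: the convex hull of finitely many points. -/
def IsPolytope {n : ℕ} (P : Set (EuclideanSpace ℝ (Fin n))) : Prop :=
  ∃ F : Finset (EuclideanSpace ℝ (Fin n)), P = convexHull ℝ (F : Set (EuclideanSpace ℝ (Fin n)))

/-- `e` is an edge of `P`: a face of `P` (the set of maximizers over `P` of a linear functional)
of dimension one. -/
def IsEdge {n : ℕ} (P e : Set (EuclideanSpace ℝ (Fin n))) : Prop :=
  IsExposed ℝ P e ∧ Module.finrank ℝ (vectorSpan ℝ e) = 1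

/-- The set of lengths of the edges of `P`. -/
def edgeLengths {n : ℕ} (P : Set (EuclideanSpace ℝ (Fin n))) : Set ℝ :=
  {ℓ | ∃ e, IsEdge P e ∧ ℓ = Metric.diam e}

/-- The minimal length `m` of an edge of `P`. -/
def minEdgeLength {n : ℕ} (P : Set (EuclideanSpace ℝ (Fin n))) : ℝ := sInf (edgeLengths P)

/-- The maximal length `M` of an edge of `P`. -/
def maxEdgeLength {n : ℕ} (P : Set (EuclideanSpace ℝ (Fin n))) : ℝ := sSup (edgeLengths P)

/-- The map `π(x) = (Uᵀ x, Vᵀ x)`. -/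
def shadowMap {n : ℕ} (U V : EuclideanSpace ℝ (Fin n)) (x : EuclideanSpace ℝ (Fin n)) :
    EuclideanSpace ℝ (Fin 2) :=
  !₂[inner ℝ U x, inner ℝ V x]

/-- The number of vertices of the shadow `π(P)`, where `π(x) = (Uᵀ x, Vᵀ x)`. -/
def shadowVertexCount {n : ℕ} (P : Set (EuclideanSpace ℝ (Fin n)))
    (U V : EuclideanSpace ℝ (Fin n)) : ℕ :=
  ((shadowMap U V '' P).extremePoints ℝ).ncard

/-- The orthogonal group `O(n)` is compact. -/
instance instCompactSpaceOrthogonalGroup (n : ℕ) :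
    CompactSpace (Matrix.orthogonalGroup (Fin n) ℝ) := by
  refine isCompact_iff_compactSpace.mp ?_
  have hK : IsCompact (Set.univ.pi fun _ : Fin n => Set.univ.pi fun _ : Fin n =>
      Set.Icc (-1 : ℝ) 1) :=
    isCompact_univ_pi fun _ => isCompact_univ_pi fun _ => isCompact_Icc
  refine IsCompact.of_isClosed_subset (s := (Set.univ.pi fun _ : Fin n => Set.univ.pi
    fun _ : Fin n => Set.Icc (-1 : ℝ) 1 : Set (Matrix (Fin n) (Fin n) ℝ))) hK ?_ ?_
  · have : ((Matrix.orthogonalGroup (Fin n) ℝ : Set (Matrix (Fin n) (Fin n) ℝ))) =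
        {A | A * star A = 1} := by
      ext A
      exact Matrix.mem_orthogonalGroup_iff (Fin n) ℝ
    rw [this]
    exact isClosed_eq (by fun_prop) continuous_const
  · intro A hA i _ j _
    have h := entry_norm_bound_of_unitary (𝕜 := ℝ) hA i j
    rwa [Real.norm_eq_abs, abs_le] at h

/-- `O(n)` carries its Borel sigma-algebra. -/
instance instMeasurableSpaceOrthogonalGroup (n : ℕ) :
    MeasurableSpace (Matrix.orthogonalGroup (Fin n) ℝ) := borel _

instance instBorelSpaceOrthogonalGroup (n : ℕ) :
    BorelSpace (Matrix.orthogonalGroup (Fin n) ℝ) := ⟨rfl⟩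

/-- The Haar probability measure on `O(n)`. -/
def haarOrthogonal (n : ℕ) : Measure (Matrix.orthogonalGroup (Fin n) ℝ) :=
  Measure.haarMeasure ⊤

/-- The `j`-th column of an orthogonal matrix. -/
def column {n : ℕ} (j : Fin n) (Q : Matrix.orthogonalGroup (Fin n) ℝ) :
    EuclideanSpace ℝ (Fin n) :=
  WithLp.toLp 2 fun i => (Q : Matrix (Fin n) (Fin n) ℝ) i j

/-- The uniform distribution of a pair `(U, V)` of orthonormal vectors in `ℝⁿ`, `n ≥ 2`: the law
of the first two columns of a Haar distributed orthogonal matrix (the unique probability measure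
on the set of orthonormal pairs that is invariant under `O(n)`). -/
def uniformOrthonormalPair (n : ℕ) (hn : 2 ≤ n) :
    Measure (EuclideanSpace ℝ (Fin n) × EuclideanSpace ℝ (Fin n)) :=
  (haarOrthogonal n).map fun Q =>
    (column ⟨0, by omega⟩ Q, column ⟨1, by omega⟩ Q)

end RandomShadow

end

/-!
The proof compares two expectations edge by edge.

Let `s` be the vertex set of `P`, and call an ordered pair `(a, b)` of vertices a directed edge of
the shadow if all other vertices project strictly to the left of the directed line from the image
of `a` to that of `b`. For almost every `(U, V)` the images of `s` are in general position
(`ae_generalPosition`), and then the shadow has as many vertices as directed edges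
(`ncard_extremePoints`); also when the shadow is a segment, which has two directed edges. So the
expected number of vertices is the sum of the probabilities `edgeProb` that `(a, b)` is a directed
edge (`integral_shadowVertexCount`).

In the shadow, the directed edges along which the `U`-coordinate increases form the lower boundary
chain. Hence `∑ ⟨b - a, U⟩⁺` over the directed edges is the width of `P` in direction `U`
(`sum_hullEdges_ofReal`).

Put `d = b - a`. Whether `(a, b)` is a directed edge depends only on the direction of the vector
`⟨d, U⟩ V - ⟨d, V⟩ U`, which is orthogonal to `d`. The orthogonal maps that fix `d` preserve
`⟨d, U⟩` and `⟨d, V⟩` and act transitively on the directions orthogonal to `d`, so this direction is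
independent of `⟨d, U⟩` (`lintegral_mul_indicator_planeNormal`). As `E ⟨d, U⟩⁺ = c ‖d‖` with a
constant `c` (`meanPosPart`), taking expectations gives
`c ∑ ‖b - a‖ edgeProb (a, b) = E (width)` (`sum_edgeProb`).

A pair with positive probability is an edge of `P`, so `m ≤ ‖b - a‖ ≤ M`. The width is at least
`|⟨x - y, U⟩|`, of mean `2 c ‖x - y‖`, which gives the lower bound; it is at most the diameter,
which gives the upper bound, since `c ≥ 1 / (8 √n)` by a comparison of the second and fourth moments
of a coordinate of `U` (`meanPosPart_ge`).
-/

noncomputable section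

namespace RandomShadow

/-! ### The action of the orthogonal group and the law of the random pair -/

section Action

variable {n : ℕ}

/-- The action of an orthogonal matrix on `ℝⁿ`, as a continuous linear map. -/
def act (Q : Matrix.orthogonalGroup (Fin n) ℝ) :
    EuclideanSpace ℝ (Fin n) →L[ℝ] EuclideanSpace ℝ (Fin n) :=
  Matrix.toEuclideanCLM (n := Fin n) (𝕜 := ℝ) (Q : Matrix (Fin n) (Fin n) ℝ)

lemma act_mul (Q R : Matrix.orthogonalGroup (Fin n) ℝ) (x : EuclideanSpace ℝ (Fin n)) :
    act (Q * R) x = act Q (act R x) := by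
  simp only [act, Submonoid.coe_mul, map_mul]
  rfl

lemma act_one (x : EuclideanSpace ℝ (Fin n)) :
    act (1 : Matrix.orthogonalGroup (Fin n) ℝ) x = x := by
  simp only [act, Submonoid.coe_one, map_one]
  rfl

lemma act_inv_act (Q : Matrix.orthogonalGroup (Fin n) ℝ) (x : EuclideanSpace ℝ (Fin n)) :
    act Q⁻¹ (act Q x) = x := by
  rw [← act_mul, inv_mul_cancel, act_one]

lemma act_act_inv (Q : Matrix.orthogonalGroup (Fin n) ℝ) (x : EuclideanSpace ℝ (Fin n)) :
    act Q (act Q⁻¹ x) = x := by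
  rw [← act_mul, mul_inv_cancel, act_one]

lemma inner_act_act (Q : Matrix.orthogonalGroup (Fin n) ℝ) (x y : EuclideanSpace ℝ (Fin n)) :
    inner ℝ (act Q x) (act Q y) = inner ℝ x y := by
  have h : star (act Q) * act Q = 1 := by
    rw [act, ← map_star, ← map_mul, Matrix.mem_unitaryGroup_iff'.1 Q.2, map_one]
  rw [← ContinuousLinearMap.adjoint_inner_right, ← ContinuousLinearMap.star_eq_adjoint,
    ← mul_apply_eq_comp, h, one_apply_eq_self]

lemma inner_act_left (Q : Matrix.orthogonalGroup (Fin n) ℝ) (x y : EuclideanSpace ℝ (Fin n)) :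
    inner ℝ (act Q x) y = inner ℝ x (act Q⁻¹ y) := by
  rw [← inner_act_act Q x, act_act_inv]

lemma continuous_act : Continuous
    fun p : Matrix.orthogonalGroup (Fin n) ℝ × EuclideanSpace ℝ (Fin n) => act p.1 p.2 := by
  have : (fun p : Matrix.orthogonalGroup (Fin n) ℝ × EuclideanSpace ℝ (Fin n) => act p.1 p.2)
      = fun p => WithLp.toLp 2 fun i => ∑ j, (p.1 : Matrix (Fin n) (Fin n) ℝ) i j * p.2 j := by
    ext p i
    simp [act, Matrix.ofLp_toEuclideanCLM, Matrix.mulVec, dotProduct]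
  rw [this]
  refine (PiLp.continuous_toLp 2 _).comp (continuous_pi fun i =>
    continuous_finsetSum _ fun j _ => ?_)
  refine Continuous.mul ?_ (by fun_prop)
  exact (Continuous.matrix_elem continuous_subtype_val i j).comp continuous_fst

lemma continuous_act_apply {Z : Type*} [TopologicalSpace Z]
    {f : Z → Matrix.orthogonalGroup (Fin n) ℝ} {g : Z → EuclideanSpace ℝ (Fin n)}
    (hf : Continuous f) (hg : Continuous g) : Continuous fun z => act (f z) (g z) := by
  have h : Continuous fun z => (f z, g z) := Continuous.prodMk hf hg
  have := continuous_act.comp h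
  exact this

lemma inner_column (Q : Matrix.orthogonalGroup (Fin n) ℝ) (i j : Fin n) :
    inner ℝ (column i Q) (column j Q) = if i = j then 1 else 0 := by
  have h := congrFun₂ ((Matrix.mem_orthogonalGroup_iff' (Fin n) ℝ).1 Q.2) i j
  rw [Matrix.one_apply, Matrix.mul_apply] at h
  rw [← h, PiLp.inner_apply]
  refine Finset.sum_congr rfl fun k _ => ?_
  simp [column, mul_comm]

lemma continuous_column (j : Fin n) : Continuous (column (n := n) j) := by
  refine (PiLp.continuous_toLp 2 _).comp (continuous_pi fun i => ?_)
  exact Continuous.matrix_elem continuous_subtype_val i j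

/-- Vectors of equal norm are related by a reflection, which fixes everything orthogonal to their
difference. -/
lemma exists_act_eq {v w : EuclideanSpace ℝ (Fin n)} (h : ‖v‖ = ‖w‖) :
    ∃ Q : Matrix.orthogonalGroup (Fin n) ℝ, act Q v = w ∧
      ∀ d, inner ℝ d (v - w) = 0 → act Q d = d := by
  set f := (ℝ ∙ (v - w))ᗮ.reflection
  let A : Matrix (Fin n) (Fin n) ℝ := (Matrix.toEuclideanCLM (n := Fin n) (𝕜 := ℝ)).symm
    (f : EuclideanSpace ℝ (Fin n) →L[ℝ] EuclideanSpace ℝ (Fin n))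
  have hA : A ∈ Matrix.orthogonalGroup (Fin n) ℝ := by
    rw [Matrix.orthogonalGroup, Matrix.mem_unitaryGroup_iff']
    have hinj : Function.Injective (Matrix.toEuclideanCLM (n := Fin n) (𝕜 := ℝ)) :=
      EquivLike.injective _
    apply hinj
    rw [map_mul, map_star, map_one, StarAlgEquiv.apply_symm_apply]
    ext1 x
    refine ext_inner_left ℝ fun y => ?_
    rw [mul_apply_eq_comp, ContinuousLinearMap.star_eq_adjoint,
      ContinuousLinearMap.adjoint_inner_right]
    exact f.inner_map_map y x
  have hact : ∀ x, act ⟨A, hA⟩ x = f x := by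
    intro x
    simp only [act, A, StarAlgEquiv.apply_symm_apply]
    rfl
  refine ⟨⟨A, hA⟩, ?_, fun d hd => ?_⟩
  · rw [hact]; exact Submodule.reflection_sub h
  · rw [hact]
    refine Submodule.reflection_mem_subspace_eq_self ?_
    rw [Submodule.mem_orthogonal_singleton_iff_inner_left]
    exact hd

variable (hn : 2 ≤ n)

lemma measurable_columns : Measurable fun Q : Matrix.orthogonalGroup (Fin n) ℝ =>
    (column (⟨0, by omega⟩ : Fin n) Q, column (⟨1, by omega⟩ : Fin n) Q) :=
  ((continuous_column _).prodMk (continuous_column _)).measurable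

instance isProbabilityMeasure_uniformOrthonormalPair :
    IsProbabilityMeasure (uniformOrthonormalPair n hn) := by
  have : IsProbabilityMeasure (haarOrthogonal n) := ⟨Measure.haarMeasure_self⟩
  exact Measure.isProbabilityMeasure_map (measurable_columns hn).aemeasurable

lemma ae_orthonormal : ∀ᵐ p ∂uniformOrthonormalPair n hn,
    inner ℝ p.1 p.1 = (1 : ℝ) ∧ inner ℝ p.2 p.2 = (1 : ℝ) ∧ inner ℝ p.1 p.2 = (0 : ℝ) := by
  have hm : MeasurableSet {p : EuclideanSpace ℝ (Fin n) × EuclideanSpace ℝ (Fin n) |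
      inner ℝ p.1 p.1 = (1 : ℝ) ∧ inner ℝ p.2 p.2 = (1 : ℝ) ∧ inner ℝ p.1 p.2 = (0 : ℝ)} := by
    refine IsClosed.measurableSet (.inter ?_ (.inter ?_ ?_)) <;>
      exact isClosed_eq (by fun_prop) (by fun_prop)
  rw [uniformOrthonormalPair, ae_map_iff (measurable_columns hn).aemeasurable hm]
  refine .of_forall fun Q => ?_
  simp only [inner_column]
  simp

lemma map_act_uniformOrthonormalPair (R : Matrix.orthogonalGroup (Fin n) ℝ) :
    (uniformOrthonormalPair n hn).map (fun p => (act R p.1, act R p.2))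
      = uniformOrthonormalPair n hn := by
  have h1 : Measurable fun p : EuclideanSpace ℝ (Fin n) × EuclideanSpace ℝ (Fin n) =>
    (act R p.1, act R p.2) := by fun_prop
  rw [uniformOrthonormalPair, Measure.map_map h1 (measurable_columns hn)]
  have : (haarOrthogonal n).map (fun Q => R * Q) = haarOrthogonal n :=
    map_mul_left_eq_self (Measure.haarMeasure ⊤) R
  conv_rhs => rw [← this, Measure.map_map (measurable_columns hn)
    (continuous_const_mul R).measurable]
  congr 1

lemma lintegral_act (R : Matrix.orthogonalGroup (Fin n) ℝ)
    {f : EuclideanSpace ℝ (Fin n) × EuclideanSpace ℝ (Fin n) → ENNReal} (hf : Measurable f) :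
    ∫⁻ p, f (act R p.1, act R p.2) ∂uniformOrthonormalPair n hn
      = ∫⁻ p, f p ∂uniformOrthonormalPair n hn := by
  conv_rhs => rw [← map_act_uniformOrthonormalPair hn R]
  rw [lintegral_map hf (by fun_prop)]

end Action

/-! ### Planar point sets in general position -/

section Planar

variable {ι : Type*} (s : Finset ι) (X Y : ι → ℝ)

/-- Twice the signed area of the triangle with vertices `p`, `q`, `x`, where the point labelled `i`
is `(X i, Y i)`; it is positive if and only if `x` lies to the left of the directed line `pq`. -/
def orient (p q x : ι) : ℝ := (X q - X p) * (Y x - Y p) - (Y q - Y p) * (X x - X p)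

/-- The planar points labelled by `s` are in general position: no three of them are collinear, and
their first coordinates are distinct. -/
structure GeneralPosition : Prop where
  orient_ne_zero : ∀ p ∈ s, ∀ q ∈ s, ∀ x ∈ s, p ≠ q → x ≠ p → x ≠ q → orient X Y p q x ≠ 0
  injOn : Set.InjOn X s

/-- `pq` is a counterclockwise directed edge of the convex hull of the points labelled by `s`: all
other points lie strictly to its left. -/
def IsHullEdge (p q : ι) : Prop := p ≠ q ∧ ∀ x ∈ s, x ≠ p → x ≠ q → 0 < orient X Y p q x

open Classical in
/-- The directed edges of the convex hull. A hull that is a segment has two of them. -/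
def hullEdges : Finset (ι × ι) := (s ×ˢ s).filter fun e => IsHullEdge s X Y e.1 e.2

variable {s X Y}

lemma mem_hullEdges {e : ι × ι} :
    e ∈ hullEdges s X Y ↔ (e.1 ∈ s ∧ e.2 ∈ s) ∧ IsHullEdge s X Y e.1 e.2 := by
  simp [hullEdges]

lemma IsHullEdge.orient_nonneg {p q x : ι} (h : IsHullEdge s X Y p q) (hx : x ∈ s) :
    0 ≤ orient X Y p q x := by
  rcases eq_or_ne x p with rfl | hp
  · simp [orient]
  rcases eq_or_ne x q with rfl | hq
  · exact le_of_eq (by simp [orient]; ring)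
  exact (h.2 x hx hp hq).le

lemma IsHullEdge.eq_or_eq {p q x : ι} (h : IsHullEdge s X Y p q) (hx : x ∈ s)
    (h0 : orient X Y p q x = 0) : x = p ∨ x = q := by
  by_contra! hne
  exact (h.2 x hx hne.1 hne.2).ne' h0

/-- A vertical line that avoids all points crosses at most one directed hull edge from left to
right, namely the one on the lower boundary. -/
lemma IsHullEdge.unique_crossing {t : ℝ} {p q p' q' : ι} (h : IsHullEdge s X Y p q)
    (h' : IsHullEdge s X Y p' q') (hp : p ∈ s) (hq : q ∈ s) (hp' : p' ∈ s) (hq' : q' ∈ s)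
    (h1 : X p < t) (h2 : t < X q) (h1' : X p' < t) (h2' : t < X q') : p' = p ∧ q' = q := by
  have a1 := mul_nonneg (sub_pos.2 h2').le (h.orient_nonneg hp')
  have a2 := mul_nonneg (sub_pos.2 h1').le (h.orient_nonneg hq')
  have a3 := mul_nonneg (sub_pos.2 h2).le (h'.orient_nonneg hp)
  have a4 := mul_nonneg (sub_pos.2 h1).le (h'.orient_nonneg hq)
  -- Each of the two edges lies weakly above the other one on the line, so they meet there.
  have e : (X q' - t) * orient X Y p q p' + (t - X p') * orient X Y p q q'
      + ((X q - t) * orient X Y p' q' p + (t - X p) * orient X Y p' q' q) = 0 := by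
    simp only [orient]; ring
  have b1 : orient X Y p q p' = 0 :=
    (mul_eq_zero.1 (by linarith : (X q' - t) * orient X Y p q p' = 0)).resolve_left
      (sub_pos.2 h2').ne'
  have b2 : orient X Y p q q' = 0 :=
    (mul_eq_zero.1 (by linarith : (t - X p') * orient X Y p q q' = 0)).resolve_left
      (sub_pos.2 h1').ne'
  constructor
  · rcases h.eq_or_eq hp' b1 with r | r
    · exact r
    · subst r; linarith
  · rcases h.eq_or_eq hq' b2 with r | r
    · subst r; linarith
    · exact r

/-- A vertical line that avoids all points but separates them crosses some directed hull edge from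
left to right: the segment between points on different sides that meets the line lowest. -/
lemma exists_crossing (hG : GeneralPosition s X Y) {t : ℝ} (ht : ∀ x ∈ s, X x ≠ t)
    (hlo : ∃ x ∈ s, X x < t) (hhi : ∃ x ∈ s, t < X x) :
    ∃ e ∈ hullEdges s X Y, X e.1 < t ∧ t < X e.2 := by
  classical
  obtain ⟨lo, hlo, hlo'⟩ := hlo
  obtain ⟨hi, hhi, hhi'⟩ := hhi
  obtain ⟨⟨p, q⟩, hpq, hmin⟩ := Finset.exists_min_image
    ((s ×ˢ s).filter fun e => X e.1 < t ∧ t < X e.2)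
    (fun e => ((X e.2 - t) * Y e.1 + (t - X e.1) * Y e.2) / (X e.2 - X e.1))
    ⟨(lo, hi), by simp [hlo, hhi, hlo', hhi']⟩
  simp only [Finset.mem_filter, Finset.mem_product] at hpq hmin
  obtain ⟨⟨hp, hq⟩, h1, h2⟩ := hpq
  have hne : p ≠ q := by rintro rfl; linarith
  have hd : 0 < X q - X p := by linarith
  refine ⟨(p, q), mem_hullEdges.2 ⟨⟨hp, hq⟩, hne, fun x hx hxp hxq => ?_⟩, h1, h2⟩
  refine lt_of_le_of_ne ?_ (hG.orient_ne_zero p hp q hq x hx hne hxp hxq).symm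
  rcases lt_or_gt_of_ne (ht x hx) with hxt | hxt
  · have h := hmin (x, q) ⟨⟨hx, hq⟩, hxt, h2⟩
    simp only at h
    rw [div_le_div_iff₀ hd (by linarith)] at h
    refine nonneg_of_mul_nonneg_right (a := X q - t) ?_ (by linarith)
    simp only [orient]
    linarith
  · have h := hmin (p, x) ⟨⟨hp, hx⟩, h1, hxt⟩
    simp only at h
    rw [div_le_div_iff₀ hd (by linarith)] at h
    refine nonneg_of_mul_nonneg_right (a := t - X p) ?_ (by linarith)
    simp only [orient]
    linarith

/-- The directed hull edges that go from left to right run through the lower boundary, so their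
horizontal extents add up to the horizontal width. -/
lemma sum_hullEdges_ofReal (hG : GeneralPosition s X Y) (hs : s.Nonempty) :
    ∑ e ∈ hullEdges s X Y, ENNReal.ofReal (X e.2 - X e.1)
      = ENNReal.ofReal (s.sup' hs X - s.inf' hs X) := by
  have hE (a b : ℝ) : ENNReal.ofReal (b - a)
      = ∫⁻ t : ℝ, (Set.Ioo a b).indicator 1 t := by
    rw [lintegral_indicator_one measurableSet_Ioo, Real.volume_Ioo]
  simp_rw [hE]
  rw [← lintegral_finsetSum _ fun e _ => measurable_one.indicator measurableSet_Ioo]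
  refine lintegral_congr_ae ?_
  have hfin : ∀ᵐ t : ℝ, t ∉ X '' (s : Set ι) :=
    measure_eq_zero_iff_ae_notMem.1 ((s.finite_toSet.image X).measure_zero volume)
  filter_upwards [hfin] with t ht
  have ht' : ∀ x ∈ s, X x ≠ t := fun x hx h => ht ⟨x, hx, h⟩
  by_cases hmem : t ∈ Set.Ioo (s.inf' hs X) (s.sup' hs X)
  · obtain ⟨hlo, hhi⟩ := hmem
    obtain ⟨e, he, h1, h2⟩ := exists_crossing hG ht' ((Finset.inf'_lt_iff hs).1 hlo)
      ((Finset.lt_sup'_iff hs).1 hhi)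
    rw [Finset.sum_eq_single_of_mem e he, Set.indicator_of_mem (show t ∈ Set.Ioo _ _ from ⟨h1, h2⟩),
      Set.indicator_of_mem (show t ∈ Set.Ioo _ _ from ⟨hlo, hhi⟩)]
    intro f hf hfe
    refine Set.indicator_of_notMem (fun hm => hfe ?_) _
    rw [mem_hullEdges] at he hf
    obtain ⟨r1, r2⟩ := he.2.unique_crossing hf.2 he.1.1 he.1.2 hf.1.1 hf.1.2 h1 h2 hm.1 hm.2
    exact Prod.ext r1 r2
  · rw [Set.indicator_of_notMem hmem]
    refine Finset.sum_eq_zero fun e he => Set.indicator_of_notMem (fun hm => hmem ?_) _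
    rw [mem_hullEdges] at he
    exact ⟨(Finset.inf'_le X he.1.1).trans_lt hm.1, hm.2.trans_le (Finset.le_sup' X he.1.2)⟩

/-- Rotating a supporting line counterclockwise around a vertex `p` until it meets a second point
yields a directed hull edge that starts at `p`. -/
lemma exists_hullEdge_of_strict_min (hG : GeneralPosition s X Y) {p : ι} (hp : p ∈ s)
    (hs : ∃ x ∈ s, x ≠ p) {α β : ℝ}
    (hαβ : ∀ x ∈ s, x ≠ p → 0 < α * (X x - X p) + β * (Y x - Y p)) :
    ∃ q, (p, q) ∈ hullEdges s X Y := by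
  classical
  obtain ⟨x₀, hx₀, hx₀p⟩ := hs
  obtain ⟨q, hq, hmin⟩ := Finset.exists_min_image (s.erase p)
    (fun x => (α * (Y x - Y p) - β * (X x - X p)) / (α * (X x - X p) + β * (Y x - Y p)))
    ⟨x₀, by simp [hx₀, hx₀p]⟩
  rw [Finset.mem_erase] at hq
  refine ⟨q, mem_hullEdges.2 ⟨⟨hp, hq.2⟩, hq.1.symm, fun x hx hxp hxq => ?_⟩⟩
  refine lt_of_le_of_ne ?_ (hG.orient_ne_zero p hp q hq.2 x hx hq.1.symm hxp hxq).symm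
  have h := hmin x (Finset.mem_erase.2 ⟨hxp, hx⟩)
  rw [div_le_div_iff₀ (hαβ q hq.2 hq.1) (hαβ x hx hxp)] at h
  have hpos : 0 < α ^ 2 + β ^ 2 := by
    by_contra! h0
    have ha : α = 0 := by nlinarith [sq_nonneg α, sq_nonneg β]
    have hb : β = 0 := by nlinarith [sq_nonneg α, sq_nonneg β]
    have := hαβ x hx hxp
    simp [ha, hb] at this
  refine nonneg_of_mul_nonneg_right ?_ hpos
  simp only [orient]
  linarith

/-- The start of a directed hull edge is the strict minimizer of a linear functional, obtained by
tilting the one that exposes the edge. -/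
lemma IsHullEdge.exists_strict_min (hG : GeneralPosition s X Y) {p q : ι}
    (h : IsHullEdge s X Y p q) (hp : p ∈ s) (hq : q ∈ s) :
    ∃ α β : ℝ, ∀ x ∈ s, x ≠ p → 0 < α * (X x - X p) + β * (Y x - Y p) := by
  classical
  obtain ⟨C, hC⟩ := (s.image fun x =>
    -((X q - X p) * (X x - X p) + (Y q - Y p) * (Y x - Y p)) / orient X Y p q x).exists_le
  refine ⟨(X q - X p) - (C + 1) * (Y q - Y p), (Y q - Y p) + (C + 1) * (X q - X p),
    fun x hx hxp => ?_⟩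
  have key : ((X q - X p) - (C + 1) * (Y q - Y p)) * (X x - X p)
      + ((Y q - Y p) + (C + 1) * (X q - X p)) * (Y x - Y p)
      = ((X q - X p) * (X x - X p) + (Y q - Y p) * (Y x - Y p))
        + (C + 1) * orient X Y p q x := by
    simp only [orient]; ring
  rw [key]
  rcases eq_or_ne x q with rfl | hxq
  · have h0 : orient X Y p x x = 0 := by simp only [orient]; ring
    have hX : X x - X p ≠ 0 := fun h => hxp (hG.injOn hx hp (sub_eq_zero.1 h))
    rw [h0, mul_zero, add_zero]
    exact add_pos_of_pos_of_nonneg (mul_self_pos.2 hX) (mul_self_nonneg _)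
  · have ho := h.2 x hx hxp hxq
    have := hC _ (Finset.mem_image_of_mem _ hx)
    rw [div_le_iff₀ ho] at this
    linarith

lemma mem_extremePoints_of_strict_min {p : ι} (hp : p ∈ s) {α β : ℝ}
    (hαβ : ∀ x ∈ s, x ≠ p → 0 < α * (X x - X p) + β * (Y x - Y p)) :
    !₂[X p, Y p] ∈ (convexHull ℝ ((fun i => !₂[X i, Y i]) '' (s : Set ι))).extremePoints ℝ := by
  set l : EuclideanSpace ℝ (Fin 2) → ℝ := fun v => α * (v 0 - X p) + β * (v 1 - Y p)
  have hl (a b : ℝ) (hab : a + b = 1) (v w) : l (a • v + b • w) = a * l v + b * l w := by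
    obtain rfl := eq_sub_of_add_eq hab
    simp [l]; ring
  have hlp : l !₂[X p, Y p] = 0 := by simp [l]
  have hsub : convexHull ℝ ((fun i => !₂[X i, Y i]) '' (s : Set ι))
      ⊆ {v | v = !₂[X p, Y p] ∨ 0 < l v} := by
    refine convexHull_min ?_ fun v hv w hw a b ha hb hab => ?_
    · rintro _ ⟨x, hx, rfl⟩
      rcases eq_or_ne x p with rfl | hxp
      · exact .inl rfl
      · exact .inr (by simpa [l] using hαβ x hx hxp)
    · rcases ha.eq_or_lt with rfl | ha
      · obtain rfl : b = 1 := by linarith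
        simpa using hw
      rcases hb.eq_or_lt with rfl | hb
      · obtain rfl : a = 1 := by linarith
        simpa using hv
      simp only [Set.mem_ofPred_eq] at hv hw ⊢
      rw [hl a b hab]
      rcases hv with rfl | hv <;> rcases hw with rfl | hw
      · left; rw [← add_smul, hab, one_smul]
      · right; rw [hlp]; positivity
      · right; rw [hlp]; positivity
      · right; positivity
  refine mem_extremePoints_iff_left.2 ⟨subset_convexHull _ _ ⟨p, hp, rfl⟩, ?_⟩
  rintro v hv w hw ⟨a, b, ha, hb, hab, h⟩
  refine (hsub hv).resolve_right fun hlv => ?_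
  have h0 : 0 = a * l v + b * l w := by rw [← hl a b hab, h, hlp]
  have hlw : 0 ≤ l w := by
    rcases hsub hw with rfl | h
    · exact hlp.ge
    · exact le_of_lt h
  have := mul_pos ha hlv
  have := mul_nonneg hb.le hlw
  linarith

lemma exists_strict_min_of_mem_extremePoints (hG : GeneralPosition s X Y) {p : ι} (hp : p ∈ s)
    (hext : !₂[X p, Y p] ∈
      (convexHull ℝ ((fun i => !₂[X i, Y i]) '' (s : Set ι))).extremePoints ℝ) :
    ∃ α β : ℝ, ∀ x ∈ s, x ≠ p → 0 < α * (X x - X p) + β * (Y x - Y p) := by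
  classical
  set z : ι → EuclideanSpace ℝ (Fin 2) := fun i => !₂[X i, Y i]
  have hnot : z p ∉ convexHull ℝ (z '' ((s.erase p : Finset ι) : Set ι)) := by
    intro hmem
    refine (((convex_convexHull ℝ _).mem_extremePoints_iff_mem_sdiff_convexHull_sdiff).1 hext).2
      (convexHull_mono ?_ hmem)
    rintro _ ⟨x, hx, rfl⟩
    have hx' := Finset.mem_erase.1 (Finset.mem_coe.1 hx)
    refine ⟨subset_convexHull _ _ ⟨x, hx'.2, rfl⟩, fun h => hx'.1 (hG.injOn hx'.2 hp ?_)⟩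
    simpa [z] using congrArg (fun v : EuclideanSpace ℝ (Fin 2) => v 0) h
  obtain ⟨f, u, hu, hf⟩ := geometric_hahn_banach_point_closed (convex_convexHull ℝ _)
    (((s.erase p).finite_toSet.image z).isClosed_convexHull ℝ) hnot
  have hexp (i : ι) : f (z i) = X i * f (EuclideanSpace.single 0 1)
      + Y i * f (EuclideanSpace.single 1 1) := by
    have : z i = X i • EuclideanSpace.single 0 1 + Y i • EuclideanSpace.single 1 1 := by
      ext j; fin_cases j <;> simp [z]
    rw [this, map_add, map_smul, map_smul, smul_eq_mul, smul_eq_mul]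
  refine ⟨f (EuclideanSpace.single 0 1), f (EuclideanSpace.single 1 1), fun x hx hxp => ?_⟩
  have := hu.trans (hf (z x) (subset_convexHull _ _ ⟨x, by simp [hx, hxp], rfl⟩))
  rw [hexp, hexp] at this
  linarith

/-- A convex polygon has as many vertices as directed edges, as each vertex starts exactly one. -/
lemma ncard_extremePoints (hG : GeneralPosition s X Y) (hs : s.Nontrivial) :
    ((convexHull ℝ ((fun i => !₂[X i, Y i]) '' (s : Set ι))).extremePoints ℝ).ncard
      = (hullEdges s X Y).card := by
  have hset : (convexHull ℝ ((fun i => !₂[X i, Y i]) '' (s : Set ι))).extremePoints ℝ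
      = (fun e : ι × ι => !₂[X e.1, Y e.1]) '' (hullEdges s X Y : Set (ι × ι)) := by
    ext v
    constructor
    · intro hv
      obtain ⟨p, hp, rfl⟩ := extremePoints_convexHull_subset hv
      obtain ⟨α, β, h⟩ := exists_strict_min_of_mem_extremePoints hG hp hv
      obtain ⟨q, hq⟩ := exists_hullEdge_of_strict_min hG hp (hs.exists_ne p) h
      exact ⟨(p, q), hq, rfl⟩
    · rintro ⟨⟨p, q⟩, he, rfl⟩
      obtain ⟨⟨hp, hq⟩, he⟩ := mem_hullEdges.1 (Finset.mem_coe.1 he)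
      obtain ⟨α, β, h⟩ := he.exists_strict_min hG hp hq
      exact mem_extremePoints_of_strict_min hp h
  rw [hset, Set.InjOn.ncard_image, Set.ncard_coe_finset]
  rintro ⟨p, q⟩ he ⟨p', q'⟩ he' h
  obtain ⟨⟨hp, hq⟩, he⟩ := mem_hullEdges.1 (Finset.mem_coe.1 he)
  obtain ⟨⟨hp', hq'⟩, he'⟩ := mem_hullEdges.1 (Finset.mem_coe.1 he')
  simp only at *
  obtain rfl : p = p' := hG.injOn hp hp'
    (by simpa using congrArg (fun v : EuclideanSpace ℝ (Fin 2) => v 0) h)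
  congr 1
  by_contra hne
  have h1 := he.2 q' hq' he'.1.symm (Ne.symm hne)
  have h2 := he'.2 q hq he.1.symm hne
  simp only [orient] at h1 h2
  linarith

end Planar

/-! ### General position of random projections and the independence of the edge normal -/

section Random

variable {n : ℕ} (hn : 2 ≤ n)

lemma measurePreserving_act (R : Matrix.orthogonalGroup (Fin n) ℝ) :
    MeasurePreserving (fun p : EuclideanSpace ℝ (Fin n) × EuclideanSpace ℝ (Fin n) =>
      (act R p.1, act R p.2)) (uniformOrthonormalPair n hn) (uniformOrthonormalPair n hn) :=
  ⟨by fun_prop, map_act_uniformOrthonormalPair hn R⟩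

/-- Averaged over `b`, the probability that a random nonzero vector is orthogonal to `b` vanishes,
as hyperplanes are Lebesgue null sets. -/
lemma ae_ae_inner_ne_zero {Ω : Type*} [MeasurableSpace Ω] {μ : Measure Ω} [SFinite μ]
    {W : Ω → EuclideanSpace ℝ (Fin n)} (hW : Measurable W) (h0 : ∀ᵐ ω ∂μ, W ω ≠ 0) :
    ∀ᵐ b : EuclideanSpace ℝ (Fin n), ∀ᵐ ω ∂μ, inner ℝ b (W ω) ≠ (0 : ℝ) := by
  have hm : MeasurableSet {x : Ω × EuclideanSpace ℝ (Fin n) | inner ℝ x.2 (W x.1) ≠ (0 : ℝ)} :=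
    (measurableSet_eq_fun (by fun_prop) measurable_const).compl
  refine (Measure.ae_ae_comm hm).1 ?_
  filter_upwards [h0] with ω hω
  have hnull := Measure.addHaar_submodule (volume : Measure (EuclideanSpace ℝ (Fin n)))
    (ℝ ∙ W ω)ᗮ (fun h => hω (by simpa using (Submodule.orthogonal_eq_top_iff _).1 h))
  filter_upwards [measure_eq_zero_iff_ae_notMem.1 hnull] with b hb h
  exact hb ((Submodule.mem_orthogonal_singleton_iff_inner_left).2 h)

include hn in
lemma span_singleton_ne_top (a : EuclideanSpace ℝ (Fin n)) : (ℝ ∙ a) ≠ ⊤ := by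
  intro h
  have h1 : Module.finrank ℝ (ℝ ∙ a) ≤ 1 :=
    (finrank_span_le_card ({a} : Set (EuclideanSpace ℝ (Fin n)))).trans (by simp)
  rw [h, finrank_top, finrank_euclideanSpace_fin] at h1
  omega

lemma ae_inner_fst_ne_zero {d : EuclideanSpace ℝ (Fin n)} (hd : d ≠ 0) :
    ∀ᵐ p ∂uniformOrthonormalPair n hn, inner ℝ d p.1 ≠ (0 : ℝ) := by
  have h0 : ∀ᵐ p ∂uniformOrthonormalPair n hn, p.1 ≠ 0 := by
    filter_upwards [ae_orthonormal hn] with p hp h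
    simp [h] at hp
  have hnull := Measure.addHaar_submodule (volume : Measure (EuclideanSpace ℝ (Fin n)))
    (ℝ ∙ (0 : EuclideanSpace ℝ (Fin n))) (span_singleton_ne_top hn 0)
  obtain ⟨b, hb, hb0⟩ := ((ae_ae_inner_ne_zero measurable_fst h0).and
    (measure_eq_zero_iff_ae_notMem.1 hnull)).exists
  have hb0' : b ≠ 0 := fun h => hb0 (by simp [h])
  have hbn : ‖b‖ ≠ 0 := norm_ne_zero_iff.2 hb0'
  obtain ⟨Q, hQ, -⟩ := exists_act_eq (v := (‖d‖ / ‖b‖) • b) (w := d)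
    (by rw [norm_smul, Real.norm_of_nonneg (by positivity)]; field_simp)
  filter_upwards [(measurePreserving_act hn Q⁻¹).quasiMeasurePreserving.ae hb] with p hp
  rw [← hQ, inner_act_left, inner_smul_left]
  refine mul_ne_zero ?_ hp
  simp [hd, hb0']

/-- A vector of the plane spanned by `U` and `V` that is orthogonal to `d`: the projection of `d`
to this plane, turned by a right angle. -/
def planeNormal (d : EuclideanSpace ℝ (Fin n))
    (p : EuclideanSpace ℝ (Fin n) × EuclideanSpace ℝ (Fin n)) : EuclideanSpace ℝ (Fin n) :=
  (inner ℝ d p.1 : ℝ) • p.2 - (inner ℝ d p.2 : ℝ) • p.1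

lemma continuous_planeNormal (d : EuclideanSpace ℝ (Fin n)) : Continuous (planeNormal d) := by
  unfold planeNormal
  fun_prop

lemma inner_planeNormal (b d : EuclideanSpace ℝ (Fin n))
    (p : EuclideanSpace ℝ (Fin n) × EuclideanSpace ℝ (Fin n)) :
    inner ℝ b (planeNormal d p)
      = (inner ℝ d p.1 : ℝ) * inner ℝ b p.2 - (inner ℝ d p.2 : ℝ) * inner ℝ b p.1 := by
  simp [planeNormal, inner_sub_right, inner_smul_right]

lemma inner_self_planeNormal (d : EuclideanSpace ℝ (Fin n))
    (p : EuclideanSpace ℝ (Fin n) × EuclideanSpace ℝ (Fin n)) :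
    inner ℝ d (planeNormal d p) = (0 : ℝ) := by
  rw [inner_planeNormal]; ring

lemma inner_act_of_fixed {Q : Matrix.orthogonalGroup (Fin n) ℝ} {d : EuclideanSpace ℝ (Fin n)}
    (hQ : act Q d = d) (x : EuclideanSpace ℝ (Fin n)) :
    (inner ℝ d (act Q x) : ℝ) = inner ℝ d x := by
  conv_lhs => rw [← hQ]
  exact inner_act_act Q d x

lemma planeNormal_act {Q : Matrix.orthogonalGroup (Fin n) ℝ} {d : EuclideanSpace ℝ (Fin n)}
    (hQ : act Q d = d) (p : EuclideanSpace ℝ (Fin n) × EuclideanSpace ℝ (Fin n)) :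
    planeNormal d (act Q p.1, act Q p.2) = act Q (planeNormal d p) := by
  simp [planeNormal, inner_act_of_fixed hQ]

lemma act_inv_fixed {Q : Matrix.orthogonalGroup (Fin n) ℝ} {d : EuclideanSpace ℝ (Fin n)}
    (hQ : act Q d = d) : act Q⁻¹ d = d := by
  conv_lhs => rw [← hQ]
  exact act_inv_act Q d

lemma ae_planeNormal_ne_zero {d : EuclideanSpace ℝ (Fin n)} (hd : d ≠ 0) :
    ∀ᵐ p ∂uniformOrthonormalPair n hn, planeNormal d p ≠ 0 := by
  filter_upwards [ae_orthonormal hn, ae_inner_fst_ne_zero hn hd] with p hp h1 h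
  have h2 := inner_planeNormal p.2 d p
  rw [h, inner_zero_right, hp.2.1, real_inner_comm p.1 p.2, hp.2.2] at h2
  exact h1 (by linarith)

/-- Nonzero vectors orthogonal to `d` are related, up to a positive factor, by an orthogonal map
that fixes `d`. -/
lemma exists_act_smul_eq {d v w : EuclideanSpace ℝ (Fin n)} (hv : v ≠ 0) (hw : w ≠ 0)
    (hdv : inner ℝ d v = (0 : ℝ)) (hdw : inner ℝ d w = (0 : ℝ)) :
    ∃ c : ℝ, 0 < c ∧ ∃ Q : Matrix.orthogonalGroup (Fin n) ℝ, act Q d = d ∧ c • act Q v = w := by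
  have hv' : 0 < ‖v‖ := norm_pos_iff.2 hv
  have hw' : 0 < ‖w‖ := norm_pos_iff.2 hw
  obtain ⟨Q, hQ, hfix⟩ := exists_act_eq (v := (‖w‖ / ‖v‖) • v) (w := w)
    (by rw [norm_smul, Real.norm_of_nonneg (by positivity)]; field_simp)
  refine ⟨‖w‖ / ‖v‖, by positivity, Q, hfix d ?_, by rw [← map_smul, hQ]⟩
  rw [inner_sub_right, inner_smul_right, hdv, hdw]
  simp

/-- Linearly independent vectors almost surely stay so under the projection to a random plane. -/
lemma ae_inner_planeNormal_ne_zero {a b : EuclideanSpace ℝ (Fin n)} (ha : a ≠ 0)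
    (hb : b ∉ (ℝ ∙ a)) :
    ∀ᵐ p ∂uniformOrthonormalPair n hn, inner ℝ b (planeNormal a p) ≠ (0 : ℝ) := by
  have hnull := Measure.addHaar_submodule (volume : Measure (EuclideanSpace ℝ (Fin n)))
    (ℝ ∙ a) (span_singleton_ne_top hn a)
  obtain ⟨b₀, hb₀, hb₀a⟩ := ((ae_ae_inner_ne_zero (continuous_planeNormal a).measurable
    (ae_planeNormal_ne_zero hn ha)).and (measure_eq_zero_iff_ae_notMem.1 hnull)).exists
  have haa : (inner ℝ a a : ℝ) ≠ 0 := inner_self_ne_zero.2 ha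
  -- Only the components orthogonal to `a` matter.
  let f : EuclideanSpace ℝ (Fin n) → EuclideanSpace ℝ (Fin n) :=
    fun x => x - ((inner ℝ a x : ℝ) / inner ℝ a a) • a
  have hf0 (x) (hx : x ∉ (ℝ ∙ a)) : f x ≠ 0 := fun h =>
    hx (by rw [sub_eq_zero.1 h]; exact Submodule.smul_mem _ _ (Submodule.mem_span_singleton_self a))
  have hfa (x) : inner ℝ a (f x) = (0 : ℝ) := by
    simp only [f]
    rw [inner_sub_right, inner_smul_right, div_mul_cancel₀ _ haa, sub_self]
  have hfw (x p) : inner ℝ x (planeNormal a p) = (inner ℝ (f x) (planeNormal a p) : ℝ) := by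
    simp only [f]
    rw [inner_sub_left, inner_smul_left, inner_self_planeNormal, mul_zero, sub_zero]
  obtain ⟨c, hc, Q, hQa, hQ⟩ := exists_act_smul_eq (hf0 b₀ hb₀a) (hf0 b hb) (hfa _) (hfa _)
  filter_upwards [(measurePreserving_act hn Q⁻¹).quasiMeasurePreserving.ae hb₀] with p hp
  rw [hfw, planeNormal_act (act_inv_fixed hQa)] at hp
  rw [hfw, ← hQ, inner_smul_left, inner_act_left]
  exact mul_ne_zero (by simpa using hc.ne') hp

/-- The subgroup of `O(n)` that fixes the vector `d`. -/
def fixingSubgroup (d : EuclideanSpace ℝ (Fin n)) :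
    Subgroup (Matrix.orthogonalGroup (Fin n) ℝ) where
  carrier := {Q | act Q d = d}
  mul_mem' {Q R} hQ hR := by
    simp only [Set.mem_ofPred_eq] at *
    rw [act_mul, hR, hQ]
  one_mem' := act_one d
  inv_mem' hQ := act_inv_fixed hQ

instance compactSpace_fixingSubgroup (d : EuclideanSpace ℝ (Fin n)) :
    CompactSpace (fixingSubgroup d) := by
  have hc : Continuous fun Q : Matrix.orthogonalGroup (Fin n) ℝ => act Q d :=
    continuous_act_apply continuous_id continuous_const
  have hclosed : IsClosed {Q : Matrix.orthogonalGroup (Fin n) ℝ | act Q d = d} :=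
    isClosed_eq hc continuous_const
  exact isCompact_iff_compactSpace.1 hclosed.isCompact

/-- The direction of `planeNormal d (U, V)` is independent of the pair `(⟨d, U⟩, ⟨d, V⟩)`: this
direction is uniformly distributed in the orthogonal complement of `d`, because the maps that fix
`d` act transitively on the directions there. -/
lemma lintegral_mul_indicator_planeNormal {d : EuclideanSpace ℝ (Fin n)} (hd : d ≠ 0)
    {g : EuclideanSpace ℝ (Fin n) × EuclideanSpace ℝ (Fin n) → ENNReal} (hg : Measurable g)
    (hinv : ∀ Q : Matrix.orthogonalGroup (Fin n) ℝ, act Q d = d →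
      ∀ p, g (act Q p.1, act Q p.2) = g p)
    {C : Set (EuclideanSpace ℝ (Fin n))} (hC : MeasurableSet C)
    (hcone : ∀ c : ℝ, 0 < c → ∀ x, c • x ∈ C ↔ x ∈ C) :
    ∫⁻ p, g p * C.indicator 1 (planeNormal d p) ∂uniformOrthonormalPair n hn
      = (∫⁻ p, g p ∂uniformOrthonormalPair n hn)
        * uniformOrthonormalPair n hn {p | planeNormal d p ∈ C} := by
  set μ := uniformOrthonormalPair n hn
  let ν : Measure (fixingSubgroup d) := Measure.haarMeasure ⊤
  have hν : IsProbabilityMeasure ν := ⟨Measure.haarMeasure_self⟩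
  have hind (c : ℝ) (hc : 0 < c) (x) :
      C.indicator (1 : EuclideanSpace ℝ (Fin n) → ENNReal) (c • x) = C.indicator 1 x := by
    by_cases h : x ∈ C
    · simp [h, (hcone c hc x).2 h]
    · simp [h, mt (hcone c hc x).1 h]
  let φ (w : EuclideanSpace ℝ (Fin n)) : ENNReal :=
    ∫⁻ γ, C.indicator 1 (act (γ⁻¹ : fixingSubgroup d).1 w) ∂ν
  have hφ (v w) (hv : v ≠ 0) (hw : w ≠ 0) (hdv : inner ℝ d v = (0 : ℝ))
      (hdw : inner ℝ d w = (0 : ℝ)) : φ v = φ w := by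
    obtain ⟨c, hc, Q, hQd, hQ⟩ := exists_act_smul_eq hv hw hdv hdw
    have h1 := lintegral_mul_left_eq_self (μ := ν)
      (fun γ => C.indicator (1 : EuclideanSpace ℝ (Fin n) → ENNReal)
        (act (γ⁻¹ : fixingSubgroup d).1 v))
      (⟨Q, hQd⟩ : fixingSubgroup d)⁻¹
    simp only [φ]
    rw [← h1]
    refine lintegral_congr fun γ => ?_
    rw [← hQ, map_smul, hind c hc, mul_inv_rev, inv_inv, Subgroup.coe_mul, act_mul]
  obtain ⟨p₀, hp₀⟩ := (ae_planeNormal_ne_zero hn hd).exists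
  have key (g : EuclideanSpace ℝ (Fin n) × EuclideanSpace ℝ (Fin n) → ENNReal)
      (hg : Measurable g) (hinv : ∀ Q : Matrix.orthogonalGroup (Fin n) ℝ, act Q d = d →
        ∀ p, g (act Q p.1, act Q p.2) = g p) :
      ∫⁻ p, g p * C.indicator 1 (planeNormal d p) ∂μ
        = (∫⁻ p, g p ∂μ) * φ (planeNormal d p₀) := by
    have hmeas : Measurable fun p => g p * C.indicator 1 (planeNormal d p) :=
      hg.mul ((measurable_one.indicator hC).comp (continuous_planeNormal d).measurable)
    have hmeas2 : Measurable fun x : fixingSubgroup d ×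
        (EuclideanSpace ℝ (Fin n) × EuclideanSpace ℝ (Fin n)) =>
        act (x.1⁻¹ : fixingSubgroup d).1 (planeNormal d x.2) := by
      refine (continuous_act_apply ?_ ?_).measurable
      · exact continuous_subtype_val.comp (continuous_inv.comp continuous_fst)
      · exact (continuous_planeNormal d).comp continuous_snd
    have hmeas3 : Measurable fun x : fixingSubgroup d ×
        (EuclideanSpace ℝ (Fin n) × EuclideanSpace ℝ (Fin n)) =>
        g x.2 * C.indicator 1 (act (x.1⁻¹ : fixingSubgroup d).1 (planeNormal d x.2)) :=
      (hg.comp measurable_snd).mul ((measurable_one.indicator hC).comp hmeas2)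
    have hmeas4 (w : EuclideanSpace ℝ (Fin n)) : Measurable fun γ : fixingSubgroup d =>
        C.indicator (1 : EuclideanSpace ℝ (Fin n) → ENNReal)
          (act (γ⁻¹ : fixingSubgroup d).1 w) := by
      have h : Measurable fun γ : fixingSubgroup d => act (γ⁻¹ : fixingSubgroup d).1 w :=
        (continuous_act_apply (continuous_subtype_val.comp continuous_inv)
          continuous_const).measurable
      exact (measurable_one.indicator hC).comp h
    calc ∫⁻ p, g p * C.indicator 1 (planeNormal d p) ∂μ
        = ∫⁻ _γ : fixingSubgroup d, ∫⁻ p, g p * C.indicator 1 (planeNormal d p) ∂μ ∂ν := by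
          simp
      _ = ∫⁻ γ : fixingSubgroup d, ∫⁻ p,
            g p * C.indicator 1 (act (γ⁻¹ : fixingSubgroup d).1 (planeNormal d p)) ∂μ ∂ν := by
          refine lintegral_congr fun γ => ?_
          rw [← lintegral_act hn (γ⁻¹ : fixingSubgroup d).1 hmeas]
          refine lintegral_congr fun p => ?_
          rw [hinv _ (γ⁻¹).2, planeNormal_act (γ⁻¹).2]
      _ = ∫⁻ p, ∫⁻ γ : fixingSubgroup d,
            g p * C.indicator 1 (act (γ⁻¹ : fixingSubgroup d).1 (planeNormal d p)) ∂ν ∂μ :=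
          lintegral_lintegral_swap hmeas3.aemeasurable
      _ = ∫⁻ p, g p * φ (planeNormal d p₀) ∂μ := by
          refine lintegral_congr_ae ?_
          filter_upwards [ae_planeNormal_ne_zero hn hd] with p hp
          rw [lintegral_const_mul]
          · congr 1
            exact hφ _ _ hp hp₀ (inner_self_planeNormal d p) (inner_self_planeNormal d p₀)
          · exact hmeas4 _
      _ = (∫⁻ p, g p ∂μ) * φ (planeNormal d p₀) := lintegral_mul_const _ hg
  rw [key g hg hinv]
  congr 1
  have h1 := key 1 measurable_one (fun _ _ _ => rfl)
  simp only [Pi.one_apply, one_mul, lintegral_one, measure_univ] at h1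
  rw [← h1]
  exact lintegral_indicator_one (hC.preimage (continuous_planeNormal d).measurable)

end Random

/-! ### Moments of a coordinate of a random unit vector -/

section Moments

variable {n : ℕ} (hn : 2 ≤ n)

/-- The distribution of `⟨d, U⟩` depends on the length of `d` only. -/
lemma map_inner_fst_eq {d d' : EuclideanSpace ℝ (Fin n)} (h : ‖d‖ = ‖d'‖) :
    (uniformOrthonormalPair n hn).map (fun p => (inner ℝ d p.1 : ℝ))
      = (uniformOrthonormalPair n hn).map (fun p => (inner ℝ d' p.1 : ℝ)) := by
  obtain ⟨Q, hQ, -⟩ := exists_act_eq h.symm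
  rw [← (measurePreserving_act hn Q).map_eq, Measure.map_map (by fun_prop) (by fun_prop),
    (measurePreserving_act hn Q).map_eq]
  congr 1
  ext p
  rw [Function.comp_apply, ← hQ, inner_act_act]

lemma integral_inner_fst_eq {d d' : EuclideanSpace ℝ (Fin n)} (h : ‖d‖ = ‖d'‖) {f : ℝ → ℝ}
    (hf : Continuous f) :
    ∫ p, f (inner ℝ d p.1) ∂uniformOrthonormalPair n hn
      = ∫ p, f (inner ℝ d' p.1) ∂uniformOrthonormalPair n hn := by
  have hc (d : EuclideanSpace ℝ (Fin n)) :
      ∫ p, f (inner ℝ d p.1) ∂uniformOrthonormalPair n hn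
        = ∫ x, f x ∂(uniformOrthonormalPair n hn).map (fun p => (inner ℝ d p.1 : ℝ)) :=
    (integral_map (Measurable.aemeasurable (by fun_prop)) hf.aestronglyMeasurable).symm
  rw [hc, hc, map_inner_fst_eq hn h]

lemma integrable_of_continuous {f : EuclideanSpace ℝ (Fin n) → ℝ} (hf : Continuous f) :
    Integrable (fun p => f p.1) (uniformOrthonormalPair n hn) := by
  obtain ⟨C, hC⟩ := (isCompact_closedBall (0 : EuclideanSpace ℝ (Fin n))
    1).exists_bound_of_continuousOn hf.continuousOn
  refine Integrable.of_bound (by fun_prop) C ?_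
  filter_upwards [ae_orthonormal hn] with p hp
  refine hC _ ?_
  rw [mem_closedBall_zero_iff, ← sq_le_one_iff₀ (norm_nonneg _), ← real_inner_self_eq_norm_sq, hp.1]

lemma ae_sum_sq_eq_one : ∀ᵐ p ∂uniformOrthonormalPair n hn, ∑ i, p.1 i ^ 2 = 1 := by
  filter_upwards [ae_orthonormal hn] with p hp
  rw [← hp.1, PiLp.inner_apply]
  simp [sq]

lemma inner_single_one (i : Fin n) (x : EuclideanSpace ℝ (Fin n)) :
    (inner ℝ (EuclideanSpace.single i 1) x : ℝ) = x i := by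
  simp [EuclideanSpace.inner_single_left]

lemma integral_pow_apply (i j : Fin n) (k : ℕ) :
    ∫ p, p.1 i ^ k ∂uniformOrthonormalPair n hn = ∫ p, p.1 j ^ k ∂uniformOrthonormalPair n hn := by
  have h := integral_inner_fst_eq hn (d := EuclideanSpace.single i 1)
    (d' := EuclideanSpace.single j 1) (by simp) (continuous_pow k)
  simpa only [inner_single_one] using h

lemma integral_sq_apply (i : Fin n) :
    n * ∫ p, p.1 i ^ 2 ∂uniformOrthonormalPair n hn = 1 := by
  have h1 : ∑ j, ∫ p, p.1 j ^ 2 ∂uniformOrthonormalPair n hn = 1 := by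
    rw [← integral_finsetSum _ fun j _ =>
      integrable_of_continuous hn (f := fun x => x j ^ 2) (by fun_prop),
      integral_congr_ae (ae_sum_sq_eq_one hn)]
    simp
  rw [Finset.sum_congr rfl fun j _ => integral_pow_apply hn j i 2] at h1
  simpa using h1

/-- The mixed fourth moments of the coordinates follow from the pure ones by rotating
`e_i ± e_j` to `√2 e_i`. -/
lemma integral_sq_mul_sq {i j : Fin n} (hij : i ≠ j) :
    ∫ p, p.1 i ^ 2 * p.1 j ^ 2 ∂uniformOrthonormalPair n hn
      = (∫ p, p.1 i ^ 4 ∂uniformOrthonormalPair n hn) / 3 := by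
  set μ := uniformOrthonormalPair n hn
  have hnorm (ε : ℝ) (hε : ε ^ 2 = 1) :
      ‖EuclideanSpace.single i (1 : ℝ) + ε • EuclideanSpace.single j (1 : ℝ)‖
        = ‖√2 • EuclideanSpace.single i (1 : ℝ)‖ := by
    rw [← sq_eq_sq₀ (norm_nonneg _) (norm_nonneg _), norm_add_sq_real, norm_smul, norm_smul,
      inner_smul_right, inner_single_one]
    simp [hij, hε]
    norm_num
  have hmom (ε : ℝ) (hε : ε ^ 2 = 1) :
      ∫ p, (p.1 i + ε * p.1 j) ^ 4 ∂μ = 4 * ∫ p, p.1 i ^ 4 ∂μ := by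
    have h := integral_inner_fst_eq hn (hnorm ε hε) (continuous_pow 4)
    simp only [inner_add_left, inner_smul_left, inner_single_one, conj_trivial, mul_pow] at h
    rw [h, integral_const_mul]
    congr 1
    rw [show (4 : ℕ) = 2 * 2 from rfl, pow_mul, Real.sq_sqrt (by norm_num)]
    norm_num
  have hint (f : EuclideanSpace ℝ (Fin n) → ℝ) (hf : Continuous f) :
      Integrable (fun p => f p.1) μ := integrable_of_continuous hn hf
  have h1 := hmom 1 (by norm_num)
  have h2 := hmom (-1) (by norm_num)
  have h3 : ∫ p, (p.1 i + 1 * p.1 j) ^ 4 ∂μ + ∫ p, (p.1 i + (-1) * p.1 j) ^ 4 ∂μ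
      = 2 * ∫ p, p.1 i ^ 4 ∂μ + 12 * ∫ p, p.1 i ^ 2 * p.1 j ^ 2 ∂μ + 2 * ∫ p, p.1 j ^ 4 ∂μ := by
    rw [← integral_const_mul, ← integral_const_mul, ← integral_const_mul,
      ← integral_add (hint (fun x => (x i + 1 * x j) ^ 4) (by fun_prop))
        (hint (fun x => (x i + (-1) * x j) ^ 4) (by fun_prop)),
      ← integral_add (hint (fun x => 2 * x i ^ 4) (by fun_prop))
        (hint (fun x => 12 * (x i ^ 2 * x j ^ 2)) (by fun_prop)),
      ← integral_add (hint (fun x => 2 * x i ^ 4 + 12 * (x i ^ 2 * x j ^ 2)) (by fun_prop))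
        (hint (fun x => 2 * x j ^ 4) (by fun_prop))]
    refine integral_congr_ae (.of_forall fun p => ?_)
    simp only
    ring
  rw [h1, h2, integral_pow_apply hn j i] at h3
  linarith

lemma integral_pow_four_le (i : Fin n) :
    (n : ℝ) ^ 2 * ∫ p, p.1 i ^ 4 ∂uniformOrthonormalPair n hn ≤ 3 := by
  set μ := uniformOrthonormalPair n hn
  set κ := ∫ p, p.1 i ^ 4 ∂μ
  have hκ : 0 ≤ κ := integral_nonneg fun p => by positivity
  have h1 : ∑ j, ∑ k, ∫ p, p.1 j ^ 2 * p.1 k ^ 2 ∂μ = 1 := by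
    have hint (j k : Fin n) : Integrable (fun p => p.1 j ^ 2 * p.1 k ^ 2) μ :=
      integrable_of_continuous hn (f := fun x => x j ^ 2 * x k ^ 2) (by fun_prop)
    rw [Finset.sum_congr rfl fun j _ => (integral_finsetSum _ fun k _ => hint j k).symm,
      ← integral_finsetSum _ fun j _ => integrable_finsetSum _ fun k _ => hint j k]
    have : ∀ᵐ p ∂μ, ∑ j, ∑ k, p.1 j ^ 2 * p.1 k ^ 2 = 1 := by
      filter_upwards [ae_sum_sq_eq_one hn] with p hp
      rw [← Finset.sum_mul_sum, hp, one_mul]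
    rw [integral_congr_ae this]
    simp
  have h2 (j k : Fin n) : κ / 3 ≤ ∫ p, p.1 j ^ 2 * p.1 k ^ 2 ∂μ := by
    rcases eq_or_ne j k with rfl | hjk
    · simp only [← pow_add]
      rw [integral_pow_apply hn j i]
      change κ / 3 ≤ κ
      linarith
    · rw [integral_sq_mul_sq hn hjk, integral_pow_apply hn j i]
  have h3 : ∑ _j : Fin n, ∑ _k : Fin n, κ / 3 ≤ 1 := by
    rw [← h1]
    exact Finset.sum_le_sum fun j _ => Finset.sum_le_sum fun k _ => h2 j k
  simp only [Finset.sum_const, Finset.card_univ, Fintype.card_fin, nsmul_eq_mul] at h3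
  linarith

lemma integral_abs_apply_ge (i : Fin n) :
    1 / (4 * √(n : ℝ)) ≤ ∫ p, |p.1 i| ∂uniformOrthonormalPair n hn := by
  set μ := uniformOrthonormalPair n hn
  set r := √(n : ℝ)
  have hn0 : (0 : ℝ) < n := by exact_mod_cast (by omega : 0 < n)
  have hr : 0 < r := Real.sqrt_pos.2 hn0
  have hrr : r ^ 2 = n := Real.sq_sqrt hn0.le
  -- The elementary inequality `y ≥ y² - y⁴ / 4` for `y = √n |x|`.
  have hpt (x : ℝ) : r * x ^ 2 - r ^ 3 / 4 * x ^ 4 ≤ |x| := by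
    have hy : 0 ≤ r * |x| := by positivity
    have h1 : (r * |x|) ^ 2 - (r * |x|) ^ 4 / 4 ≤ r * |x| := by
      have h2 : 0 ≤ 1 - r * |x| + (r * |x|) ^ 3 / 4 := by
        nlinarith [mul_nonneg hy (sq_nonneg (r * |x| - 6 / 5)), sq_nonneg (r * |x| - 6 / 5)]
      nlinarith [mul_nonneg hy h2]
    have h3 : |x| ^ 2 = x ^ 2 := sq_abs x
    have h4 : |x| ^ 4 = x ^ 4 := by rw [show 4 = 2 * 2 from rfl, pow_mul, pow_mul, sq_abs]
    rw [mul_pow, mul_pow, h3, h4] at h1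
    refine le_of_mul_le_mul_left ?_ hr
    linarith
  have hint (f : EuclideanSpace ℝ (Fin n) → ℝ) (hf : Continuous f) :
      Integrable (fun p => f p.1) μ := integrable_of_continuous hn hf
  have h1 : ∫ p, (r * p.1 i ^ 2 - r ^ 3 / 4 * p.1 i ^ 4) ∂μ ≤ ∫ p, |p.1 i| ∂μ :=
    integral_mono (hint (fun x => r * x i ^ 2 - r ^ 3 / 4 * x i ^ 4) (by fun_prop))
      (hint (fun x => |x i|) (by fun_prop)) fun p => hpt _
  rw [integral_sub (hint (fun x => r * x i ^ 2) (by fun_prop))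
    (hint (fun x => r ^ 3 / 4 * x i ^ 4) (by fun_prop)), integral_const_mul,
    integral_const_mul] at h1
  refine le_trans ?_ h1
  have h2 := integral_sq_apply hn i
  have h3 := integral_pow_four_le hn i
  rw [← hrr] at h2 h3
  rw [div_le_iff₀ (by positivity)]
  nlinarith

/-- The mean positive part of a coordinate of a uniformly distributed unit vector. -/
def meanPosPart : ENNReal :=
  ∫⁻ p, ENNReal.ofReal (p.1 ⟨0, by omega⟩) ∂uniformOrthonormalPair n hn

lemma lintegral_ofReal_inner_fst (d : EuclideanSpace ℝ (Fin n)) :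
    ∫⁻ p, ENNReal.ofReal (inner ℝ d p.1) ∂uniformOrthonormalPair n hn
      = ENNReal.ofReal ‖d‖ * meanPosPart hn := by
  have hc (d : EuclideanSpace ℝ (Fin n)) :
      ∫⁻ p, ENNReal.ofReal (inner ℝ d p.1) ∂uniformOrthonormalPair n hn
        = ∫⁻ x, ENNReal.ofReal x
          ∂(uniformOrthonormalPair n hn).map (fun p => (inner ℝ d p.1 : ℝ)) :=
    (lintegral_map ENNReal.measurable_ofReal (by fun_prop)).symm
  rw [hc, map_inner_fst_eq hn (d' := ‖d‖ • EuclideanSpace.single ⟨0, by omega⟩ 1)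
    (by simp [norm_smul]), ← hc, meanPosPart, ← lintegral_const_mul _ (by fun_prop)]
  refine lintegral_congr fun p => ?_
  rw [inner_smul_left, inner_single_one, ENNReal.ofReal_mul (by simp)]
  simp

lemma ofReal_add_ofReal_neg (x : ℝ) :
    ENNReal.ofReal x + ENNReal.ofReal (-x) = ENNReal.ofReal |x| := by
  rcases le_total 0 x with h | h
  · rw [abs_of_nonneg h, ENNReal.ofReal_of_nonpos (by linarith : -x ≤ 0), add_zero]
  · rw [abs_of_nonpos h, ENNReal.ofReal_of_nonpos h, zero_add]

lemma lintegral_ofReal_abs_inner_fst (d : EuclideanSpace ℝ (Fin n)) :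
    ∫⁻ p, ENNReal.ofReal |inner ℝ d p.1| ∂uniformOrthonormalPair n hn
      = 2 * ENNReal.ofReal ‖d‖ * meanPosPart hn := by
  simp_rw [← ofReal_add_ofReal_neg]
  rw [lintegral_add_left (by fun_prop), lintegral_ofReal_inner_fst]
  simp_rw [← inner_neg_left]
  rw [lintegral_ofReal_inner_fst, norm_neg]
  ring

lemma meanPosPart_ge : ENNReal.ofReal (1 / (8 * √(n : ℝ))) ≤ meanPosPart hn := by
  have h1 := lintegral_ofReal_abs_inner_fst hn (EuclideanSpace.single ⟨0, by omega⟩ 1)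
  simp_rw [inner_single_one] at h1
  rw [← ofReal_integral_eq_lintegral_ofReal
    (integrable_of_continuous hn (f := fun x => |x _|) (by fun_prop))
    (.of_forall fun p => abs_nonneg _)] at h1
  have h2 := ENNReal.ofReal_le_ofReal (integral_abs_apply_ge hn ⟨0, by omega⟩)
  rw [h1] at h2
  have h3 : 1 / (4 * √(n : ℝ)) = 2 * (1 / (8 * √(n : ℝ))) := by ring
  rw [h3, ENNReal.ofReal_mul (by norm_num)] at h2
  simp only [PiLp.norm_single, norm_one, ENNReal.ofReal_one, mul_one, ENNReal.ofReal_ofNat] at h2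
  exact (ENNReal.mul_le_mul_iff_right (by norm_num) (by norm_num)).1 h2

lemma meanPosPart_ne_zero : meanPosPart hn ≠ 0 := by
  have hn0 : (0 : ℝ) < n := by exact_mod_cast (by omega : 0 < n)
  refine ((ENNReal.ofReal_pos.2 ?_).trans_le (meanPosPart_ge hn)).ne'
  have := Real.sqrt_pos.2 hn0
  positivity

lemma meanPosPart_le_one : meanPosPart hn ≤ 1 := by
  refine (lintegral_mono_ae (g := fun _ => 1) ?_).trans (by simp)
  filter_upwards [ae_sum_sq_eq_one hn] with p hp
  rw [ENNReal.ofReal_le_one]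
  have h := Finset.single_le_sum (f := fun i => p.1 i ^ 2) (fun i _ => sq_nonneg _)
    (Finset.mem_univ ⟨0, by omega⟩)
  rw [hp] at h
  exact (le_abs_self _).trans ((sq_le_one_iff_abs_le_one _).1 h)

end Moments

/-! ### Edges of the shadow and edges of the polytope -/

section Polytope

variable {n : ℕ}

/-- A face of a polytope is spanned by the generators of the polytope that it contains. -/
lemma isExposed_eq_convexHull_inter {s : Finset (EuclideanSpace ℝ (Fin n))}
    {e : Set (EuclideanSpace ℝ (Fin n))}
    (he : IsExposed ℝ (convexHull ℝ (s : Set (EuclideanSpace ℝ (Fin n)))) e) :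
    e = convexHull ℝ (e ∩ s) := by
  have hK := s.finite_toSet.isCompact_convexHull ℝ
  have hconv : Convex ℝ e := he.convex (convex_convexHull ℝ _)
  refine Set.Subset.antisymm ?_ (convexHull_min Set.inter_subset_left hconv)
  have hsub : e.extremePoints ℝ ⊆ e ∩ s := fun x hx =>
    ⟨extremePoints_subset hx, extremePoints_convexHull_subset
      (he.isExtreme.extremePoints_subset_extremePoints hx)⟩
  conv_lhs => rw [← closure_convexHull_extremePoints (he.isCompact hK) hconv]
  refine closure_minimal (convexHull_mono hsub) ?_
  exact (s.finite_toSet.subset Set.inter_subset_right).isClosed_convexHull ℝ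

/-- A polytope is spanned by its vertices, no three of which are collinear. -/
lemma IsPolytope.exists_vertices {P : Set (EuclideanSpace ℝ (Fin n))} (hP : IsPolytope P) :
    ∃ s : Finset (EuclideanSpace ℝ (Fin n)),
      P = convexHull ℝ (s : Set (EuclideanSpace ℝ (Fin n))) ∧
      ∀ p ∈ s, ∀ q ∈ s, ∀ x ∈ s, p ≠ q → x ≠ p → x ≠ q → x - p ∉ (ℝ ∙ (q - p)) := by
  classical
  obtain ⟨F, rfl⟩ := hP
  set P := convexHull ℝ (F : Set (EuclideanSpace ℝ (Fin n)))
  have hfin : (P.extremePoints ℝ).Finite :=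
    F.finite_toSet.subset extremePoints_convexHull_subset
  refine ⟨hfin.toFinset, ?_, ?_⟩
  · rw [hfin.coe_toFinset, ← (hfin.isClosed_convexHull ℝ).closure_eq]
    exact (closure_convexHull_extremePoints (F.finite_toSet.isCompact_convexHull ℝ)
      (convex_convexHull ℝ _)).symm
  · intro p hp q hq x hx hpq hxp hxq h
    rw [hfin.mem_toFinset, mem_extremePoints_iff_forall_segment] at hp hq hx
    obtain ⟨c, hc⟩ := Submodule.mem_span_singleton.1 h
    have hcol : Collinear ℝ {p, q, x} := by
      rw [collinear_iff_of_mem (p₀ := p) (by simp)]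
      refine ⟨q - p, ?_⟩
      rintro y (rfl | rfl | rfl)
      · exact ⟨0, by simp⟩
      · exact ⟨1, by simp⟩
      · exact ⟨c, by simp [hc]⟩
    rcases hcol.wbtw_or_wbtw_or_wbtw with h | h | h <;> rw [← mem_segment_iff_wbtw] at h
    · rcases hq.2 _ hp.1 _ hx.1 h with r | r
      exacts [hpq r, hxq r]
    · rcases hx.2 _ hq.1 _ hp.1 h with r | r
      exacts [hxq r.symm, hxp r.symm]
    · rcases hp.2 _ hx.1 _ hq.1 h with r | r
      exacts [hxp r, hpq r.symm]

variable (s : Finset (EuclideanSpace ℝ (Fin n)))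

/-- The vectors `w` such that all points of `s` other than `e.1` and `e.2` lie strictly on the
positive side of the hyperplane through `e.1` with normal `w`. The orthogonality of `w` to
`e.2 - e.1`, which makes `e` an exposed edge, is not part of the definition. -/
def edgeCone (e : EuclideanSpace ℝ (Fin n) × EuclideanSpace ℝ (Fin n)) :
    Set (EuclideanSpace ℝ (Fin n)) :=
  {w | ∀ x ∈ s, x ≠ e.1 → x ≠ e.2 → 0 < (inner ℝ (x - e.1) w : ℝ)}

lemma measurableSet_edgeCone (e : EuclideanSpace ℝ (Fin n) × EuclideanSpace ℝ (Fin n)) :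
    MeasurableSet (edgeCone s e) := by
  simp only [edgeCone, Set.ofPred_forall]
  refine Finset.measurableSet_biInter s fun x _ => .iInter fun _ => .iInter fun _ => ?_
  exact measurableSet_lt measurable_const (by fun_prop)

lemma smul_mem_edgeCone_iff (e : EuclideanSpace ℝ (Fin n) × EuclideanSpace ℝ (Fin n))
    (c : ℝ) (hc : 0 < c) (w : EuclideanSpace ℝ (Fin n)) :
    c • w ∈ edgeCone s e ↔ w ∈ edgeCone s e := by
  simp [edgeCone, inner_smul_right, hc]

lemma orient_inner (p : EuclideanSpace ℝ (Fin n) × EuclideanSpace ℝ (Fin n))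
    (a b x : EuclideanSpace ℝ (Fin n)) :
    orient (fun i => inner ℝ p.1 i) (fun i => inner ℝ p.2 i) a b x
      = inner ℝ (x - a) (planeNormal (b - a) p) := by
  rw [inner_planeNormal]
  simp only [orient, inner_sub_left, real_inner_comm]

open Classical in
/-- Whether `e` is a directed edge of the shadow depends only on the direction of
`planeNormal (e.2 - e.1)`. -/
lemma hullEdges_inner (p : EuclideanSpace ℝ (Fin n) × EuclideanSpace ℝ (Fin n)) :
    hullEdges s (fun i => inner ℝ p.1 i) (fun i => inner ℝ p.2 i)
      = s.offDiag.filter fun e => planeNormal (e.2 - e.1) p ∈ edgeCone s e := by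
  ext e
  rw [mem_hullEdges, Finset.mem_filter, Finset.mem_offDiag]
  simp only [IsHullEdge, orient_inner, edgeCone, Set.mem_ofPred_eq]
  tauto

variable {s}

lemma ae_generalPosition (hn : 2 ≤ n)
    (hs : ∀ p ∈ s, ∀ q ∈ s, ∀ x ∈ s, p ≠ q → x ≠ p → x ≠ q → x - p ∉ (ℝ ∙ (q - p))) :
    ∀ᵐ p ∂uniformOrthonormalPair n hn,
      GeneralPosition s (fun i => inner ℝ p.1 i) (fun i => inner ℝ p.2 i) := by
  have h1 : ∀ᵐ p ∂uniformOrthonormalPair n hn, ∀ a ∈ s, ∀ b ∈ s, ∀ x ∈ s,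
      a ≠ b → x ≠ a → x ≠ b → (inner ℝ (x - a) (planeNormal (b - a) p) : ℝ) ≠ 0 := by
    refine (Filter.eventually_all_finset s).2 fun a ha => (Filter.eventually_all_finset s).2
      fun b hb => (Filter.eventually_all_finset s).2 fun x hx => ?_
    by_cases hc : a ≠ b ∧ x ≠ a ∧ x ≠ b
    · filter_upwards [ae_inner_planeNormal_ne_zero hn (sub_ne_zero.2 hc.1.symm)
        (hs a ha b hb x hx hc.1 hc.2.1 hc.2.2)] with p hp _ _ _
      exact hp
    · exact .of_forall fun p h1 h2 h3 => (hc ⟨h1, h2, h3⟩).elim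
  have h2 : ∀ᵐ p ∂uniformOrthonormalPair n hn, ∀ a ∈ s, ∀ b ∈ s,
      a ≠ b → (inner ℝ (a - b) p.1 : ℝ) ≠ 0 := by
    refine (Filter.eventually_all_finset s).2 fun a ha => (Filter.eventually_all_finset s).2
      fun b hb => ?_
    by_cases hc : a ≠ b
    · filter_upwards [ae_inner_fst_ne_zero hn (sub_ne_zero.2 hc)] with p hp _
      exact hp
    · exact .of_forall fun p h => (hc h).elim
  filter_upwards [h1, h2] with p hp1 hp2
  refine ⟨fun a ha b hb x hx h1 h2 h3 => ?_, fun a ha b hb hab => ?_⟩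
  · rw [orient_inner]
    exact hp1 a ha b hb x hx h1 h2 h3
  · by_contra hne
    refine hp2 a ha b hb hne ?_
    change (inner ℝ p.1 a : ℝ) = inner ℝ p.1 b at hab
    rw [inner_sub_left, real_inner_comm p.1 a, real_inner_comm p.1 b, hab, sub_self]

lemma shadowMap_image_convexHull (U V : EuclideanSpace ℝ (Fin n))
    (t : Set (EuclideanSpace ℝ (Fin n))) :
    shadowMap U V '' convexHull ℝ t
      = convexHull ℝ ((fun i => !₂[inner ℝ U i, inner ℝ V i]) '' t) := by
  have h : IsLinearMap ℝ (shadowMap U V) := by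
    constructor
    · intro x y
      ext i; fin_cases i <;> simp [shadowMap, inner_add_right]
    · intro c x
      ext i; fin_cases i <;> simp [shadowMap, inner_smul_right]
  exact h.image_convexHull t

/-- The probability that `e` is a directed edge of the shadow of `s`, provided that `e.1` and `e.2`
are distinct elements of `s`. -/
def edgeProb (hn : 2 ≤ n) (s : Finset (EuclideanSpace ℝ (Fin n)))
    (e : EuclideanSpace ℝ (Fin n) × EuclideanSpace ℝ (Fin n)) : ENNReal :=
  uniformOrthonormalPair n hn {p | planeNormal (e.2 - e.1) p ∈ edgeCone s e}

/-- The expected number of vertices of the shadow is the sum of the edge probabilities. -/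
lemma integral_shadowVertexCount (hn : 2 ≤ n) (hnt : s.Nontrivial)
    (hs : ∀ p ∈ s, ∀ q ∈ s, ∀ x ∈ s, p ≠ q → x ≠ p → x ≠ q → x - p ∉ (ℝ ∙ (q - p))) :
    Integrable (fun p : EuclideanSpace ℝ (Fin n) × EuclideanSpace ℝ (Fin n) =>
        (shadowVertexCount (convexHull ℝ (s : Set (EuclideanSpace ℝ (Fin n)))) p.1 p.2 : ℝ))
      (uniformOrthonormalPair n hn) ∧
    ∫ p, (shadowVertexCount (convexHull ℝ (s : Set (EuclideanSpace ℝ (Fin n)))) p.1 p.2 : ℝ)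
      ∂uniformOrthonormalPair n hn = (∑ e ∈ s.offDiag, edgeProb hn s e).toReal := by
  classical
  let N (p : EuclideanSpace ℝ (Fin n) × EuclideanSpace ℝ (Fin n)) : ENNReal :=
    ∑ e ∈ s.offDiag, (planeNormal (e.2 - e.1) ⁻¹' edgeCone s e).indicator 1 p
  have hmeas (e : EuclideanSpace ℝ (Fin n) × EuclideanSpace ℝ (Fin n)) :
      MeasurableSet (planeNormal (e.2 - e.1) ⁻¹' edgeCone s e) :=
    (measurableSet_edgeCone s e).preimage (continuous_planeNormal _).measurable
  have hN : Measurable N :=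
    Finset.measurable_fun_sum _ fun e _ => measurable_one.indicator (hmeas e)
  have hNint : ∫⁻ p, N p ∂uniformOrthonormalPair n hn = ∑ e ∈ s.offDiag, edgeProb hn s e := by
    rw [lintegral_finsetSum _ fun e _ => measurable_one.indicator (hmeas e)]
    exact Finset.sum_congr rfl fun e _ => lintegral_indicator_one (hmeas e)
  have hfin : ∑ e ∈ s.offDiag, edgeProb hn s e ≠ ⊤ :=
    ENNReal.sum_ne_top.2 fun e _ => measure_ne_top _ _
  have hae : (fun p : EuclideanSpace ℝ (Fin n) × EuclideanSpace ℝ (Fin n) =>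
      (shadowVertexCount (convexHull ℝ (s : Set (EuclideanSpace ℝ (Fin n)))) p.1 p.2 : ℝ))
      =ᵐ[uniformOrthonormalPair n hn] fun p => (N p).toReal := by
    filter_upwards [ae_generalPosition hn hs] with p hp
    rw [shadowVertexCount, shadowMap_image_convexHull, ncard_extremePoints hp hnt,
      hullEdges_inner, Finset.card_filter]
    simp only [N, Set.indicator_apply, Set.mem_preimage, Pi.one_apply]
    rw [ENNReal.toReal_sum (fun e _ => by split_ifs <;> simp)]
    push_cast
    refine Finset.sum_congr rfl fun e _ => ?_
    split_ifs <;> simp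
  constructor
  · refine (integrable_toReal_of_lintegral_ne_top hN.aemeasurable ?_).congr hae.symm
    rwa [hNint]
  · rw [integral_congr_ae hae, integral_toReal hN.aemeasurable, hNint]
    exact ae_lt_top hN (by rwa [hNint])

/-- The probability-weighted total length of the edges equals the mean width, up to the constant
`meanPosPart`. -/
lemma sum_edgeProb (hn : 2 ≤ n) (hne : s.Nonempty)
    (hs : ∀ p ∈ s, ∀ q ∈ s, ∀ x ∈ s, p ≠ q → x ≠ p → x ≠ q → x - p ∉ (ℝ ∙ (q - p))) :
    ∑ e ∈ s.offDiag, ENNReal.ofReal ‖e.2 - e.1‖ * meanPosPart hn * edgeProb hn s e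
      = ∫⁻ p, ENNReal.ofReal (s.sup' hne (fun i => inner ℝ p.1 i)
          - s.inf' hne (fun i => inner ℝ p.1 i)) ∂uniformOrthonormalPair n hn := by
  classical
  have h1 (e) (he : e ∈ s.offDiag) :
      ENNReal.ofReal ‖e.2 - e.1‖ * meanPosPart hn * edgeProb hn s e
        = ∫⁻ p, ENNReal.ofReal (inner ℝ (e.2 - e.1) p.1)
            * (edgeCone s e).indicator 1 (planeNormal (e.2 - e.1) p)
            ∂uniformOrthonormalPair n hn := by
    have hd : e.2 - e.1 ≠ 0 := sub_ne_zero.2 (Finset.mem_offDiag.1 he).2.2.symm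
    rw [lintegral_mul_indicator_planeNormal hn hd (by fun_prop) (fun Q hQ p => by
      rw [inner_act_of_fixed hQ]) (measurableSet_edgeCone s e) (smul_mem_edgeCone_iff s e),
      lintegral_ofReal_inner_fst]
    rfl
  rw [Finset.sum_congr rfl h1, ← lintegral_finsetSum]
  · refine lintegral_congr_ae ?_
    filter_upwards [ae_generalPosition hn hs] with p hp
    rw [← sum_hullEdges_ofReal hp hne, hullEdges_inner, Finset.sum_filter]
    refine Finset.sum_congr rfl fun e _ => ?_
    rw [Set.indicator_apply, Pi.one_apply, mul_ite, mul_one, mul_zero, inner_sub_left,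
      real_inner_comm p.1, real_inner_comm p.1]
  · intro e _
    exact Measurable.mul (by fun_prop) ((measurable_one.indicator (measurableSet_edgeCone s e)).comp
      (continuous_planeNormal _).measurable)

lemma inner_nonneg_of_mem_edgeCone {e : EuclideanSpace ℝ (Fin n) × EuclideanSpace ℝ (Fin n)}
    {w : EuclideanSpace ℝ (Fin n)} (hw : w ∈ edgeCone s e) (h0 : inner ℝ (e.2 - e.1) w = (0 : ℝ))
    {x : EuclideanSpace ℝ (Fin n)} (hx : x ∈ s) : (0 : ℝ) ≤ inner ℝ (x - e.1) w := by
  rcases eq_or_ne x e.1 with rfl | h1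
  · simp
  rcases eq_or_ne x e.2 with rfl | h2
  · exact h0.ge
  · exact (hw x hx h1 h2).le

/-- A pair that is an edge of some shadow is an edge of the polytope: the normal in the projection
plane exposes it. -/
lemma isEdge_of_mem_edgeCone {e : EuclideanSpace ℝ (Fin n) × EuclideanSpace ℝ (Fin n)}
    (he : e ∈ s.offDiag) {w : EuclideanSpace ℝ (Fin n)} (hw : w ∈ edgeCone s e)
    (h0 : inner ℝ (e.2 - e.1) w = (0 : ℝ)) :
    IsEdge (convexHull ℝ (s : Set (EuclideanSpace ℝ (Fin n)))) (convexHull ℝ {e.1, e.2}) := by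
  obtain ⟨h1, h2, h12⟩ := Finset.mem_offDiag.1 he
  constructor
  · set l : StrongDual ℝ (EuclideanSpace ℝ (Fin n)) := -innerSL ℝ w
    have hl (x) : l x = -inner ℝ (x - e.1) w - inner ℝ e.1 w := by
      simp [l, inner_sub_left, real_inner_comm]
    have hle : ∀ y ∈ convexHull ℝ (s : Set (EuclideanSpace ℝ (Fin n))), l y ≤ l e.1 := by
      refine fun y hy => convexHull_min (fun x hx => ?_)
        (convex_halfSpace_le l.isLinear (l e.1)) hy
      have := inner_nonneg_of_mem_edgeCone hw h0 hx
      change l x ≤ l e.1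
      rw [hl, hl e.1, sub_self, inner_zero_left]
      linarith
    have hl2 : l e.2 = l e.1 := by rw [hl, hl e.1, h0]; simp
    have hexp := ContinuousLinearMap.toExposed.isExposed (l := l)
      (A := convexHull ℝ (s : Set (EuclideanSpace ℝ (Fin n))))
    have hinter : l.toExposed (convexHull ℝ (s : Set (EuclideanSpace ℝ (Fin n)))) ∩ s
        = {e.1, e.2} := by
      ext x
      constructor
      · rintro ⟨⟨-, hx⟩, hxs⟩
        have h := hx e.1 (subset_convexHull _ _ h1)
        rw [hl, hl x, sub_self, inner_zero_left] at h
        by_contra hne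
        simp only [Set.mem_insert_iff, Set.mem_singleton_iff, not_or] at hne
        have := hw x hxs hne.1 hne.2
        linarith
      · rintro (rfl | rfl)
        · exact ⟨⟨subset_convexHull _ _ h1, hle⟩, h1⟩
        · exact ⟨⟨subset_convexHull _ _ h2, fun y hy => (hle y hy).trans hl2.ge⟩, h2⟩
    rw [← hinter, ← isExposed_eq_convexHull_inter hexp]
    exact hexp
  · rw [← direction_affineSpan, affineSpan_convexHull, direction_affineSpan, vectorSpan_pair,
      finrank_span_singleton]
    exact vsub_ne_zero.2 h12

lemma norm_mem_edgeLengths {hn : 2 ≤ n}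
    {e : EuclideanSpace ℝ (Fin n) × EuclideanSpace ℝ (Fin n)}
    (he : e ∈ s.offDiag) (hpos : edgeProb hn s e ≠ 0) :
    ‖e.2 - e.1‖ ∈ edgeLengths (convexHull ℝ (s : Set (EuclideanSpace ℝ (Fin n)))) := by
  obtain ⟨p, hp⟩ := nonempty_of_measure_ne_zero hpos
  refine ⟨_, isEdge_of_mem_edgeCone he hp (inner_self_planeNormal _ p), ?_⟩
  rw [convexHull_diam, Metric.diam_pair, dist_comm, dist_eq_norm]

lemma bddAbove_edgeLengths (s : Finset (EuclideanSpace ℝ (Fin n))) :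
    BddAbove (edgeLengths (convexHull ℝ (s : Set (EuclideanSpace ℝ (Fin n))))) := by
  refine ⟨Metric.diam (convexHull ℝ (s : Set (EuclideanSpace ℝ (Fin n)))), ?_⟩
  rintro _ ⟨e, he, rfl⟩
  exact Metric.diam_mono he.1.subset (s.finite_toSet.isCompact_convexHull ℝ).isBounded

lemma maxEdgeLength_nonneg (P : Set (EuclideanSpace ℝ (Fin n))) : 0 ≤ maxEdgeLength P :=
  Real.sSup_nonneg (by rintro _ ⟨e, -, rfl⟩; exact Metric.diam_nonneg)

lemma bddBelow_edgeLengths (P : Set (EuclideanSpace ℝ (Fin n))) : BddBelow (edgeLengths P) :=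
  ⟨0, by rintro _ ⟨e, -, rfl⟩; exact Metric.diam_nonneg⟩

/-- An edge contains two of the generators, so its length is at least their minimal distance. -/
lemma minEdgeLength_pos
    (hne : (edgeLengths (convexHull ℝ (s : Set (EuclideanSpace ℝ (Fin n))))).Nonempty) :
    0 < minEdgeLength (convexHull ℝ (s : Set (EuclideanSpace ℝ (Fin n)))) := by
  classical
  have key : ∀ ℓ ∈ edgeLengths (convexHull ℝ (s : Set (EuclideanSpace ℝ (Fin n)))),
      ∃ e ∈ s.offDiag, dist e.1 e.2 ≤ ℓ := by
    rintro _ ⟨e, he, rfl⟩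
    have hnt : (e ∩ s).Nontrivial := by
      by_contra h
      have h' := Set.not_nontrivial_iff.1 h
      have hsub : e.Subsingleton := by
        rw [isExposed_eq_convexHull_inter he.1]
        rcases h'.eq_empty_or_singleton with h | ⟨x, h⟩ <;> rw [h] <;> simp
      have := he.2
      rw [vectorSpan_of_subsingleton ℝ hsub, finrank_bot] at this
      omega
    obtain ⟨x, hx, y, hy, hxy⟩ := hnt
    exact ⟨(x, y), Finset.mem_offDiag.2 ⟨hx.2, hy.2, hxy⟩, Metric.dist_le_diam_of_mem
      ((s.finite_toSet.isCompact_convexHull ℝ).isBounded.subset he.1.subset) hx.1 hy.1⟩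
  obtain ⟨ℓ₀, h₀⟩ := hne
  obtain ⟨e₀, he₀, -⟩ := key _ h₀
  obtain ⟨e₁, he₁, hmin⟩ := s.offDiag.exists_min_image (fun e => dist e.1 e.2) ⟨e₀, he₀⟩
  refine (dist_pos.2 (Finset.mem_offDiag.1 he₁).2.2).trans_le (le_csInf ⟨ℓ₀, h₀⟩ fun ℓ hℓ => ?_)
  obtain ⟨e, he, hle⟩ := key ℓ hℓ
  exact (hmin e he).trans hle

end Polytope

/-! ### The two bounds -/

section Bounds

variable {n : ℕ} {s : Finset (EuclideanSpace ℝ (Fin n))} (hn : 2 ≤ n)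
  (hs : ∀ p ∈ s, ∀ q ∈ s, ∀ x ∈ s, p ≠ q → x ≠ p → x ≠ q → x - p ∉ (ℝ ∙ (q - p)))

include hs

/-- Bounding every edge by the longest one and the width from below by `|⟨x - y, U⟩|`. -/
lemma two_mul_dist_le {x y : EuclideanSpace ℝ (Fin n)} (hx : x ∈ s) (hy : y ∈ s) :
    2 * dist x y ≤ maxEdgeLength (convexHull ℝ (s : Set (EuclideanSpace ℝ (Fin n))))
      * (∑ e ∈ s.offDiag, edgeProb hn s e).toReal := by
  set M := maxEdgeLength (convexHull ℝ (s : Set (EuclideanSpace ℝ (Fin n))))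
  have hM : 0 ≤ M := maxEdgeLength_nonneg _
  have hfin : ∑ e ∈ s.offDiag, edgeProb hn s e ≠ ⊤ :=
    ENNReal.sum_ne_top.2 fun e _ => measure_ne_top _ _
  have h1 : ∑ e ∈ s.offDiag, ENNReal.ofReal ‖e.2 - e.1‖ * meanPosPart hn * edgeProb hn s e
      ≤ ENNReal.ofReal M * (∑ e ∈ s.offDiag, edgeProb hn s e) * meanPosPart hn := by
    rw [mul_right_comm, Finset.mul_sum]
    refine Finset.sum_le_sum fun e he => ?_
    rcases eq_or_ne (edgeProb hn s e) 0 with h | h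
    · simp [h]
    · gcongr
      exact le_csSup (bddAbove_edgeLengths s) (norm_mem_edgeLengths he h)
  have h2 : 2 * ENNReal.ofReal ‖x - y‖ * meanPosPart hn
      ≤ ∑ e ∈ s.offDiag, ENNReal.ofReal ‖e.2 - e.1‖ * meanPosPart hn * edgeProb hn s e := by
    rw [sum_edgeProb hn ⟨x, hx⟩ hs, ← lintegral_ofReal_abs_inner_fst]
    refine lintegral_mono fun p => ENNReal.ofReal_le_ofReal ?_
    have a1 := Finset.le_sup' (fun i => (inner ℝ p.1 i : ℝ)) hx
    have a2 := Finset.le_sup' (fun i => (inner ℝ p.1 i : ℝ)) hy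
    have a3 := Finset.inf'_le (fun i => (inner ℝ p.1 i : ℝ)) hx
    have a4 := Finset.inf'_le (fun i => (inner ℝ p.1 i : ℝ)) hy
    rw [inner_sub_left, real_inner_comm p.1 x, real_inner_comm p.1 y, abs_le]
    constructor <;> linarith
  have h3 := (ENNReal.mul_le_mul_iff_left (meanPosPart_ne_zero hn)
    ((meanPosPart_le_one hn).trans_lt ENNReal.one_lt_top).ne).1 (h2.trans h1)
  have h4 := ENNReal.toReal_mono (ENNReal.mul_ne_top ENNReal.ofReal_ne_top hfin) h3
  rw [ENNReal.toReal_mul, ENNReal.toReal_mul, ENNReal.toReal_ofReal (norm_nonneg _),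
    ENNReal.toReal_ofReal hM] at h4
  simpa [dist_eq_norm] using h4

/-- Bounding every edge by the shortest one and the width from above by the diameter. -/
lemma minEdgeLength_mul_le (hne : s.Nonempty)
    (hm : 0 < minEdgeLength (convexHull ℝ (s : Set (EuclideanSpace ℝ (Fin n))))) :
    minEdgeLength (convexHull ℝ (s : Set (EuclideanSpace ℝ (Fin n))))
        * (∑ e ∈ s.offDiag, edgeProb hn s e).toReal * (1 / (8 * √(n : ℝ)))
      ≤ Metric.diam (convexHull ℝ (s : Set (EuclideanSpace ℝ (Fin n)))) := by
  set m := minEdgeLength (convexHull ℝ (s : Set (EuclideanSpace ℝ (Fin n))))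
  set D := Metric.diam (convexHull ℝ (s : Set (EuclideanSpace ℝ (Fin n))))
  have hfin : ∑ e ∈ s.offDiag, edgeProb hn s e ≠ ⊤ :=
    ENNReal.sum_ne_top.2 fun e _ => measure_ne_top _ _
  have h1 : ENNReal.ofReal m * (∑ e ∈ s.offDiag, edgeProb hn s e) * meanPosPart hn
      ≤ ∑ e ∈ s.offDiag, ENNReal.ofReal ‖e.2 - e.1‖ * meanPosPart hn * edgeProb hn s e := by
    rw [mul_right_comm, Finset.mul_sum]
    refine Finset.sum_le_sum fun e he => ?_
    rcases eq_or_ne (edgeProb hn s e) 0 with h | h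
    · simp [h]
    · gcongr
      exact csInf_le (bddBelow_edgeLengths _) (norm_mem_edgeLengths he h)
  have h2 : ∑ e ∈ s.offDiag, ENNReal.ofReal ‖e.2 - e.1‖ * meanPosPart hn * edgeProb hn s e
      ≤ ENNReal.ofReal D := by
    rw [sum_edgeProb hn hne hs]
    refine (lintegral_mono_ae (g := fun _ => ENNReal.ofReal D) ?_).trans (by simp)
    filter_upwards [ae_orthonormal hn] with p hp
    refine ENNReal.ofReal_le_ofReal ?_
    obtain ⟨x, hx, hx'⟩ := s.exists_mem_eq_sup' hne (fun i => (inner ℝ p.1 i : ℝ))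
    obtain ⟨y, hy, hy'⟩ := s.exists_mem_eq_inf' hne (fun i => (inner ℝ p.1 i : ℝ))
    have hU : ‖p.1‖ = 1 := by
      rw [← sq_eq_sq₀ (norm_nonneg _) zero_le_one, ← real_inner_self_eq_norm_sq, hp.1, one_pow]
    rw [hx', hy', ← inner_sub_right]
    calc inner ℝ p.1 (x - y) ≤ ‖p.1‖ * ‖x - y‖ := real_inner_le_norm _ _
      _ = dist x y := by rw [hU, one_mul, dist_eq_norm]
      _ ≤ D := Metric.dist_le_diam_of_mem (s.finite_toSet.isCompact_convexHull ℝ).isBounded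
          (subset_convexHull _ _ hx) (subset_convexHull _ _ hy)
  have h3 : ENNReal.ofReal m * (∑ e ∈ s.offDiag, edgeProb hn s e)
      * ENNReal.ofReal (1 / (8 * √(n : ℝ))) ≤ ENNReal.ofReal D :=
    (mul_le_mul_right (meanPosPart_ge hn) _).trans (h1.trans h2)
  have h4 := ENNReal.toReal_mono ENNReal.ofReal_ne_top h3
  rwa [ENNReal.toReal_mul, ENNReal.toReal_mul, ENNReal.toReal_ofReal hm.le,
    ENNReal.toReal_ofReal (by positivity), ENNReal.toReal_ofReal Metric.diam_nonneg] at h4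

end Bounds

end RandomShadow

end

theorem theorem1 :
    ∃ K : ℝ, ∀ (n : ℕ) (hn : 2 ≤ n) (P : Set (EuclideanSpace ℝ (Fin n))),
      RandomShadow.IsPolytope P → P.Nontrivial →
      MeasureTheory.Integrable
          (fun p : EuclideanSpace ℝ (Fin n) × EuclideanSpace ℝ (Fin n) =>
            (RandomShadow.shadowVertexCount P p.1 p.2 : ℝ))
          (RandomShadow.uniformOrthonormalPair n hn) ∧
        2 / RandomShadow.maxEdgeLength P * Metric.diam P ≤
          ∫ p, (RandomShadow.shadowVertexCount P p.1 p.2 : ℝ)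
            ∂(RandomShadow.uniformOrthonormalPair n hn) ∧
        ∫ p, (RandomShadow.shadowVertexCount P p.1 p.2 : ℝ)
            ∂(RandomShadow.uniformOrthonormalPair n hn) ≤
          K * √(n : ℝ) * Real.pi / (2 * RandomShadow.minEdgeLength P) * Metric.diam P := by
  refine ⟨6, fun n hn P hP hPnt => ?_⟩
  obtain ⟨s, rfl, hs⟩ := hP.exists_vertices
  have hnt : s.Nontrivial := by
    by_contra h
    refine Set.not_subsingleton_iff.2 hPnt ?_
    rcases (Set.not_nontrivial_iff.1 h).eq_empty_or_singleton with h | ⟨x, h⟩ <;> rw [h] <;> simp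
  obtain ⟨hint, heq⟩ := RandomShadow.integral_shadowVertexCount hn hnt hs
  refine ⟨hint, ?_⟩
  rw [heq]
  set S := (∑ e ∈ s.offDiag, RandomShadow.edgeProb hn s e).toReal
  set M := RandomShadow.maxEdgeLength (convexHull ℝ (s : Set (EuclideanSpace ℝ (Fin n))))
  have hS : 0 ≤ S := ENNReal.toReal_nonneg
  have hM0 : 0 ≤ M := RandomShadow.maxEdgeLength_nonneg _
  have hlow (x) (hx : x ∈ s) (y) (hy : y ∈ s) : 2 * dist x y ≤ M * S :=
    RandomShadow.two_mul_dist_le hn hs hx hy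
  obtain ⟨x, hx, y, hy, hxy⟩ := id hnt
  have hMS : 0 < M * S := (mul_pos two_pos (dist_pos.2 hxy)).trans_le (hlow x hx y hy)
  have hM : 0 < M := pos_of_mul_pos_left hMS hS
  constructor
  · have hD : Metric.diam (convexHull ℝ (s : Set (EuclideanSpace ℝ (Fin n)))) ≤ M * S / 2 := by
      rw [convexHull_diam]
      refine Metric.diam_le_of_forall_dist_le (by linarith) fun x hx y hy => ?_
      linarith [hlow x hx y hy]
    rw [div_mul_eq_mul_div, div_le_iff₀ hM]
    linarith
  · have hedge : (RandomShadow.edgeLengths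
        (convexHull ℝ (s : Set (EuclideanSpace ℝ (Fin n))))).Nonempty := by
      by_contra h
      refine hMS.ne' ?_
      have : ∑ e ∈ s.offDiag, RandomShadow.edgeProb hn s e = 0 :=
        Finset.sum_eq_zero fun e he => by
          by_contra hne
          exact h ⟨_, RandomShadow.norm_mem_edgeLengths he hne⟩
      simp [S, this]
    have hm := RandomShadow.minEdgeLength_pos hedge
    have hup := RandomShadow.minEdgeLength_mul_le hn hs ⟨x, hx⟩ hm
    set m := RandomShadow.minEdgeLength (convexHull ℝ (s : Set (EuclideanSpace ℝ (Fin n))))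
    set D := Metric.diam (convexHull ℝ (s : Set (EuclideanSpace ℝ (Fin n))))
    have hr : 0 < √(n : ℝ) := Real.sqrt_pos.2 (by exact_mod_cast (by omega : 0 < n))
    have hD : 0 ≤ D := Metric.diam_nonneg
    rw [mul_one_div, div_le_iff₀ (by positivity)] at hup
    rw [div_mul_eq_mul_div, le_div_iff₀ (by positivity)]
    have hpi := mul_le_mul_of_nonneg_left Real.pi_gt_three.le (mul_nonneg hD hr.le)
    nlinarith [mul_nonneg hD hr.le]
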